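/- Let $n\ge 1$ and $n<p<\infty$, and let $q$ be the H\"older conjugate of $p$, $\frac1p+\frac1q=1$. Let $\mathcal D^{1,p}(\mathbb R^n)$ be the space of all $u\in L^1_{\mathrm{loc}}(\mathbb R^n)$ whose weak gradient $Du$ lies in $L^p(\mathbb R^n;\mathbb R^n)$, each $u$ being identified with its continuous representative, and write $\|Du\|_p=\left(\int_{\mathbb R^n}|Du|^p\,dx\right)^{1/p}$. Let $\rho$ be a signed Borel measure on $\mathbb R^n$ with compact support, $\rho(\mathbb R^n)=0$ and $\int_{\mathbb R^n}y\,d\rho(y)\ne 0$. For $u\in\mathcal D^{1,p}(\mathbb R^n)$ put $$[u]_\rho=\sup_{S}\frac{\left|\int_{\mathbb R^n}u\,d(S_\#\rho)\right|}{\left|\int_{\mathbb R^n}x\,d(S_\#\rho)(x)\right|^{1-n/p}},$$ where $S$ runs over all similarities $S(y)=\lambda Oy+z$ of $\mathbb R^n$ with $\lambda>0$, $O\in \mathrm O(n)$ and $z\in\mathbb R^n$, and $S_\#\rho$ is the push-forward of $\rho$ under $S$. For $F\in L^q(\mathbb R^n;\mathbb R^n)$ say that $\operatorname{div}F=\rho$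 in $\mathbb R^n$ if $-\int_{\mathbb R^n}Dv\cdot F\,dy=\int_{\mathbb R^n}v\,d\rho$ for all $v\in\mathcal D^{1,p}(\mathbb R^n)$. Then there is at least one $F\in L^q(\mathbb R^n;\mathbb R^n)$ with $\operatorname{div}F=\rho$, there is a smallest constant $C_*$ for which the generalized Morrey inequality $$[u]_\rho\le C_*\|Du\|_p\qquad\text{for all }u\in\mathcal D^{1,p}(\mathbb R^n)$$ holds, and $$C_*=\frac{\inf\left\{\left(\int_{\mathbb R^n}|F(y)|^q\,dy\right)^{1/q}:\ F\in L^q(\mathbb R^n;\mathbb R^n),\ \operatorname{div}F=\rho\ \text{in}\ \mathbb R^n\right\}}{\left|\int_{\mathbb R^n}y\,d\rho(y)\right|^{1-n/p}}.$$ -/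

import Mathlib

open MeasureTheory
open scoped ENNReal ContDiff

noncomputable section

namespace GenMorrey

/-- `ℝⁿ` with its Euclidean norm. -/
abbrev Space (n : ℕ) : Type := EuclideanSpace ℝ (Fin n)

/-- `g` is the weak (distributional) gradient of `u` on `ℝⁿ`: both are locally integrable and
`∫ u Dφ = - ∫ φ g` for every smooth compactly supported `φ`. -/
def HasWeakGradient {n : ℕ} (u : Space n → ℝ) (g : Space n → Space n) : Prop :=
  LocallyIntegrable u ∧ LocallyIntegrable g ∧
    ∀ φ : Space n → ℝ, ContDiff ℝ ∞ φ → HasCompactSupport φ →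
      ∫ x, u x • gradient φ x = - ∫ x, φ x • g x

open scoped Classical in
/-- The weak gradient `Du` (unique up to a null set when it exists; `0` by convention otherwise). -/
def weakGradient {n : ℕ} (u : Space n → ℝ) : Space n → Space n :=
  if h : ∃ g, HasWeakGradient u g then h.choose else 0

/-- The homogeneous Sobolev space `𝒟^{1,p}(ℝⁿ)`, for `p > n`: locally integrable functions whose
weak gradient lies in `L^p`, each of them identified with its continuous representative. -/
def D1p (n : ℕ) (p : ℝ) : Set (Space n → ℝ) :=
  {u | Continuous u ∧ LocallyIntegrable u ∧
    ∃ g, HasWeakGradient u g ∧ MemLp g (ENNReal.ofReal p) volume}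

/-- The norm `‖G‖_r = (∫ |G|^r)^{1/r}` of a vector field `G ∈ L^r(ℝⁿ; ℝⁿ)`. -/
def fieldNorm {n : ℕ} (r : ℝ) (G : Space n → Space n) : ℝ :=
  (eLpNorm G (ENNReal.ofReal r) volume).toReal

/-- The similarity transformations `y ↦ c O y + z` of `ℝⁿ`, with `c > 0`, `O ∈ O(n)`, `z ∈ ℝⁿ`. -/
def similarities (n : ℕ) : Set (Space n → Space n) :=
  {S | ∃ (c : ℝ) (O : Space n ≃ₗᵢ[ℝ] Space n) (z : Space n),
    0 < c ∧ S = fun y => c • O y + z}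

/-- The standing assumptions on the signed Borel measure `ρ`. -/
structure Admissible {n : ℕ} (ρ : SignedMeasure (Space n)) : Prop where
  isCompact_support : IsCompact ρ.variation.support
  total_eq_zero : ρ Set.univ = 0
  firstMoment_ne_zero : ∫ᵛ y, y ∂<•ρ ≠ 0

/-- The quotient `|∫ u dμ| / |∫ x dμ(x)|^{1 - n/p}`. -/
def ratio {n : ℕ} (p : ℝ) (μ : SignedMeasure (Space n)) (u : Space n → ℝ) : ℝ :=
  |∫ᵛ x, u x ∂•μ| / ‖∫ᵛ x, x ∂<•μ‖ ^ (1 - (n : ℝ) / p)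

/-- The seminorm `[u]_ρ`: the supremum of the quotients over all push-forwards `μ = S_# ρ` of `ρ`
by similarities `S`, taken in the extended reals so that no boundedness is presupposed. -/
def rhoSeminorm {n : ℕ} (p : ℝ) (ρ : SignedMeasure (Space n)) (u : Space n → ℝ) : EReal :=
  ⨆ S ∈ similarities n, (ratio p (ρ.map S) u : EReal)

/-- The real constants `C` for which the generalized Morrey inequality `[u]_ρ ≤ C ‖Du‖_p` holds
for every `u ∈ 𝒟^{1,p}(ℝⁿ)`. -/
def morreyConstants {n : ℕ} (p : ℝ) (ρ : SignedMeasure (Space n)) : Set ℝ :=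
  {C | ∀ u ∈ D1p n p, rhoSeminorm p ρ u ≤ ((C * fieldNorm p (weakGradient u) : ℝ) : EReal)}

/-- `div F = ρ` in `ℝⁿ`, tested against all of `𝒟^{1,p}(ℝⁿ)`. -/
def DivEq {n : ℕ} (p : ℝ) (F : Space n → Space n) (ρ : SignedMeasure (Space n)) : Prop :=
  ∀ v ∈ D1p n p, - ∫ y, inner ℝ (weakGradient v y) (F y) = ∫ᵛ y, v y ∂•ρ

/-- The set of norms `‖F‖_q` of the fields `F ∈ L^q(ℝⁿ; ℝⁿ)` with `div F = ρ`. -/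
def divFieldNorms {n : ℕ} (p q : ℝ) (ρ : SignedMeasure (Space n)) : Set ℝ :=
  {t | ∃ F : Space n → Space n,
    MemLp F (ENNReal.ofReal q) volume ∧ DivEq p F ρ ∧ t = fieldNorm q F}

end GenMorrey

end

noncomputable section

namespace GenMorrey

variable {n : ℕ}

/-! Up to a power of the first moment, the best constant is the norm of the functional `u ↦ ∫ u dρ`
measured against `‖Du‖_p`, and this norm is computed by duality.

Composing `u` with a similarity of ratio `c` multiplies `‖Du‖_p` by `c ^ (1 - n/p)`. The first
moment of the pushed-forward measure is `c` times a rotated copy of the original one, the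
translation dropping out because `ρ` has total mass zero. The two powers of `c` cancel, so the
inequality for all similarities is equivalent to the one for the identity
(`Admissible.mem_morreyConstants_iff`).

If `div F = ρ`, Hölder bounds the functional by `‖F‖_q ‖Du‖_p`. Conversely, a bound `C` lets the
functional factor through `D` on the range of `D` in `L^p`; Hahn–Banach extends it without
increasing the norm, and Riesz representation turns the extension into a field with `‖F‖_q ≤ C`
(`Admissible.exists_field`).

Some finite bound exists by Morrey's inequality (`exists_morrey_bound`): `u` differs from a constant
by at most a multiple of `(‖x‖ + 1) ‖Du‖_p`, and `ρ` annihilates constants and has compact support.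
-/

/-! ### Weak gradients and the space `𝒟^{1,p}` -/

theorem HasWeakGradient.ae_unique {u : Space n → ℝ} {g g' : Space n → Space n}
    (h : HasWeakGradient u g) (h' : HasWeakGradient u g') : g =ᵐ[volume] g' := by
  refine ae_eq_of_integral_contDiff_smul_eq h.2.1 h'.2.1 fun φ hφ hc => ?_
  exact neg_injective ((h.2.2 φ hφ hc).symm.trans (h'.2.2 φ hφ hc))

theorem continuous_gradient {φ : Space n → ℝ} (hφ : ContDiff ℝ ∞ φ) :
    Continuous (gradient φ) :=
  (InnerProductSpace.toDual ℝ (Space n)).symm.continuous.comp (hφ.continuous_fderiv (by simp))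

theorem hasCompactSupport_gradient {φ : Space n → ℝ} (hc : HasCompactSupport φ) :
    HasCompactSupport (gradient φ) :=
  (hc.fderiv (𝕜 := ℝ)).comp_left (g := (InnerProductSpace.toDual ℝ (Space n)).symm) (map_zero _)

theorem integrable_smul_gradient {u φ : Space n → ℝ} (hu : LocallyIntegrable u)
    (hφ : ContDiff ℝ ∞ φ) (hc : HasCompactSupport φ) :
    Integrable fun x => u x • gradient φ x :=
  hu.integrable_smul_right_of_hasCompactSupport (continuous_gradient hφ)
    (hasCompactSupport_gradient hc)

theorem integrable_testFunction_smul {φ : Space n → ℝ} {g : Space n → Space n}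
    (hg : LocallyIntegrable g) (hφ : ContDiff ℝ ∞ φ) (hc : HasCompactSupport φ) :
    Integrable fun x => φ x • g x :=
  hg.integrable_smul_left_of_hasCompactSupport hφ.continuous hc

theorem HasWeakGradient.add {u v : Space n → ℝ} {g h : Space n → Space n}
    (hu : HasWeakGradient u g) (hv : HasWeakGradient v h) :
    HasWeakGradient (u + v) (g + h) := by
  refine ⟨hu.1.add hv.1, hu.2.1.add hv.2.1, fun φ hφ hc => ?_⟩
  simp only [Pi.add_apply, add_smul, smul_add]
  rw [integral_add (integrable_smul_gradient hu.1 hφ hc) (integrable_smul_gradient hv.1 hφ hc),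
    integral_add (integrable_testFunction_smul hu.2.1 hφ hc)
      (integrable_testFunction_smul hv.2.1 hφ hc), hu.2.2 φ hφ hc, hv.2.2 φ hφ hc, neg_add]

theorem HasWeakGradient.const_smul {u : Space n → ℝ} {g : Space n → Space n}
    (hu : HasWeakGradient u g) (c : ℝ) : HasWeakGradient (c • u) (c • g) := by
  refine ⟨hu.1.smul c, hu.2.1.smul c, fun φ hφ hc => ?_⟩
  simp only [Pi.smul_apply, smul_assoc, smul_comm _ c]
  rw [integral_smul, integral_smul, hu.2.2 φ hφ hc, smul_neg]

theorem weakGradient_spec {u : Space n → ℝ} (h : ∃ g, HasWeakGradient u g) :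
    HasWeakGradient u (weakGradient u) := by
  rw [weakGradient, dif_pos h]
  exact h.choose_spec

theorem HasWeakGradient.weakGradient_ae {u : Space n → ℝ} {g : Space n → Space n}
    (h : HasWeakGradient u g) : weakGradient u =ᵐ[volume] g :=
  (weakGradient_spec ⟨g, h⟩).ae_unique h

variable {p q : ℝ}

theorem D1p.hasWeakGradient {u : Space n → ℝ} (hu : u ∈ D1p n p) :
    HasWeakGradient u (weakGradient u) :=
  weakGradient_spec (hu.2.2.imp fun _ h => h.1)

theorem D1p.memLp {u : Space n → ℝ} (hu : u ∈ D1p n p) :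
    MemLp (weakGradient u) (ENNReal.ofReal p) volume := by
  obtain ⟨g, hg, hm⟩ := hu.2.2
  exact hm.ae_eq hg.weakGradient_ae.symm

/-- The space `𝒟^{1,p}(ℝⁿ)` as a linear subspace of the space of all functions. -/
def D1pSubmodule (n : ℕ) (p : ℝ) : Submodule ℝ (Space n → ℝ) where
  carrier := D1p n p
  zero_mem' := ⟨continuous_zero, locallyIntegrable_zero, 0,
    ⟨locallyIntegrable_zero, locallyIntegrable_zero, fun φ _ _ => by simp⟩, MemLp.zero⟩
  add_mem' := by
    rintro u v ⟨hu, hu', g, hg, hgm⟩ ⟨hv, hv', h, hh, hhm⟩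
    exact ⟨hu.add hv, hu'.add hv', g + h, hg.add hh, hgm.add hhm⟩
  smul_mem' := by
    rintro c u ⟨hu, hu', g, hg, hgm⟩
    exact ⟨hu.const_smul c, hu'.smul c, c • g, hg.const_smul c, hgm.const_smul c⟩

/-- The weak gradient as a linear map from `𝒟^{1,p}(ℝⁿ)` to `L^p(ℝⁿ; ℝⁿ)`. -/
def gradientLp (n : ℕ) (p : ℝ) [Fact (1 ≤ ENNReal.ofReal p)] :
    D1pSubmodule n p →ₗ[ℝ] Lp (Space n) (ENNReal.ofReal p) (volume : Measure (Space n)) where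
  toFun u := (D1p.memLp u.2).toLp _
  map_add' u v := by
    rw [← MemLp.toLp_add]
    exact MemLp.toLp_congr _ _
      ((D1p.hasWeakGradient u.2).add (D1p.hasWeakGradient v.2)).weakGradient_ae
  map_smul' c u := by
    rw [RingHom.id_apply, ← MemLp.toLp_const_smul]
    exact MemLp.toLp_congr _ _ ((D1p.hasWeakGradient u.2).const_smul c).weakGradient_ae

theorem norm_gradientLp [Fact (1 ≤ ENNReal.ofReal p)] (u : D1pSubmodule n p) :
    ‖gradientLp n p u‖ = fieldNorm p (weakGradient (u : Space n → ℝ)) :=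
  Lp.norm_toLp _ (D1p.memLp u.2)

/-! ### Behaviour under similarities -/

section Similarity

/-- The similarity `y ↦ c O y + z`, as a homeomorphism. -/
def similarity (c : ℝ) (hc : c ≠ 0) (O : Space n ≃ₗᵢ[ℝ] Space n) (z : Space n) :
    Space n ≃ₜ Space n :=
  O.toHomeomorph.trans ((Homeomorph.smulOfNeZero c hc).trans (Homeomorph.addRight z))

theorem map_similarity_volume {c : ℝ} (hc : 0 < c) (O : Space n ≃ₗᵢ[ℝ] Space n) (z : Space n) :
    Measure.map (similarity c hc.ne' O z) volume
      = ENNReal.ofReal ((c ^ n)⁻¹) • (volume : Measure (Space n)) := by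
  have h1 : (similarity c hc.ne' O z : Space n → Space n)
      = (fun x => x + z) ∘ (fun x => c • x) ∘ O := rfl
  rw [h1, ← Measure.map_map (by fun_prop) (by fun_prop),
    ← Measure.map_map (by fun_prop) (by fun_prop), O.measurePreserving.map_eq,
    Measure.map_addHaar_smul _ hc.ne', Measure.map_smul,
    (measurePreserving_add_right volume z).map_eq, finrank_euclideanSpace_fin,
    abs_of_pos (by positivity)]

theorem integral_comp_similarity {E : Type*} [NormedAddCommGroup E] [NormedSpace ℝ E]
    {c : ℝ} (hc : 0 < c) (O : Space n ≃ₗᵢ[ℝ] Space n) (z : Space n) (f : Space n → E) :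
    ∫ y, f (c • O y + z) = (c ^ n)⁻¹ • ∫ y, f y := by
  have := (similarity c hc.ne' O z).measurableEmbedding.integral_map (μ := volume) f
  rw [map_similarity_volume hc, integral_smul_measure, ENNReal.toReal_ofReal (by positivity)] at this
  exact this.symm

theorem locallyIntegrable_comp_similarity {E : Type*} [NormedAddCommGroup E]
    {c : ℝ} (hc : 0 < c) (O : Space n ≃ₗᵢ[ℝ] Space n) (z : Space n) {f : Space n → E}
    (hf : LocallyIntegrable f) : LocallyIntegrable fun y => f (c • O y + z) := by
  have := (locallyIntegrable_map_homeomorph (similarity c hc.ne' O z) (f := f) (μ := volume)).1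
  refine this ?_
  rw [map_similarity_volume hc]
  intro x
  obtain ⟨s, hs, hi⟩ := hf x
  refine ⟨s, hs, ?_⟩
  rw [IntegrableOn, Measure.restrict_smul]
  exact Integrable.smul_measure hi ENNReal.ofReal_ne_top

theorem eLpNorm_comp_similarity {E : Type*} [NormedAddCommGroup E] {c : ℝ} (hc : 0 < c)
    (O : Space n ≃ₗᵢ[ℝ] Space n) (z : Space n) (hp : 0 < p) (f : Space n → E) :
    eLpNorm (fun y => f (c • O y + z)) (ENNReal.ofReal p) volume
      = ENNReal.ofReal (c ^ (-(n : ℝ) / p)) * eLpNorm f (ENNReal.ofReal p) volume := by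
  have h := (similarity c hc.ne' O z).measurableEmbedding.eLpNorm_map_measure
    (g := f) (p := ENNReal.ofReal p) (μ := volume)
  rw [map_similarity_volume hc, eLpNorm_smul_measure_of_ne_zero (by simp; positivity)] at h
  rw [show (fun y => f (c • O y + z)) = f ∘ similarity c hc.ne' O z from rfl, ← h, smul_eq_mul,
    ENNReal.toReal_div, ENNReal.toReal_ofReal hp.le, ENNReal.toReal_one,
    ENNReal.ofReal_rpow_of_pos (by positivity), ← Real.rpow_natCast, ← Real.rpow_neg hc.le,
    ← Real.rpow_mul hc.le]
  congr 3
  ring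

theorem memLp_comp_similarity {E : Type*} [NormedAddCommGroup E] {c : ℝ} (hc : 0 < c)
    (O : Space n ≃ₗᵢ[ℝ] Space n) (z : Space n) {r : ℝ≥0∞} {f : Space n → E}
    (hf : MemLp f r volume) : MemLp (fun y => f (c • O y + z)) r volume := by
  have h := (similarity c hc.ne' O z).measurableEmbedding.memLp_map_measure_iff
    (g := f) (p := r) (μ := volume)
  rw [map_similarity_volume hc] at h
  exact h.1 (hf.smul_measure ENNReal.ofReal_ne_top)

/-- The similarity is moved onto the test function: `φ` becomes `ψ = φ ∘ S⁻¹`, the chain rule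
contributes the operator `T = c Oᵀ`, and the Jacobian `c⁻ⁿ` is the same on both sides. -/
theorem HasWeakGradient.comp_similarity {u : Space n → ℝ} {g : Space n → Space n}
    (hu : HasWeakGradient u g) {c : ℝ} (hc : 0 < c) (O : Space n ≃ₗᵢ[ℝ] Space n) (z : Space n) :
    HasWeakGradient (fun y => u (c • O y + z)) (fun y => c • O.symm (g (c • O y + z))) := by
  set T : Space n →L[ℝ] Space n := c • (O.symm.toContinuousLinearEquiv : Space n →L[ℝ] Space n)
    with hT
  have hTa : ∀ x, T x = c • O.symm x := fun x => rfl
  have hloc : LocallyIntegrable fun y => g (c • O y + z) :=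
    locallyIntegrable_comp_similarity hc O z hu.2.1
  refine ⟨locallyIntegrable_comp_similarity hc O z hu.1, ?_, fun φ hφ hφc => ?_⟩
  · intro x
    obtain ⟨s, hs, hi⟩ := hloc x
    exact ⟨s, hs, T.integrable_comp hi⟩
  · set e := similarity c hc.ne' O z
    have he : ∀ y, c • O y + z = e y := fun y => rfl
    set ψ : Space n → ℝ := φ ∘ e.symm with hψ
    have hes : (e.symm : Space n → Space n) = fun y => O.symm (c⁻¹ • (y - z)) := by
      ext1 y
      rw [e.symm_apply_eq, ← he]
      simp [smul_smul, hc.ne']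
    have hψs : ContDiff ℝ ∞ ψ := by
      rw [hψ, hes]
      exact hφ.comp (O.symm.contDiff.comp (by fun_prop))
    have hψc : HasCompactSupport ψ := hφc.comp_homeomorph e.symm
    have hφψ : ∀ y, φ y = ψ (e y) := fun y => by simp [hψ]
    have hgrad : ∀ y, gradient φ y = T (gradient ψ (e y)) := by
      intro y
      refine ext_inner_right ℝ fun w => ?_
      rw [inner_gradient_left, hTa, inner_smul_left, LinearIsometryEquiv.inner_map_eq_flip,
        LinearIsometryEquiv.symm_symm, inner_gradient_left]
      have h1 : HasFDerivAt ψ (fderiv ℝ ψ (e y)) (e y) :=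
        (hψs.differentiable (by simp) _).hasFDerivAt
      have h2 : HasFDerivAt e (c • (O.toContinuousLinearEquiv : Space n →L[ℝ] Space n)) y :=
        ((O.toContinuousLinearEquiv.hasFDerivAt).const_smul c).add_const z
      have h3 := h1.comp y h2
      have h4 : ψ ∘ e = φ := by ext y; simp [hψ]
      rw [h4] at h3
      rw [h3.fderiv]
      simp
    calc ∫ y, u (c • O y + z) • gradient φ y
        = ∫ y, (fun x => T (u x • gradient ψ x)) (c • O y + z) := by
          congr 1; ext1 y
          simp only [hgrad, map_smul, he]
      _ = (c ^ n)⁻¹ • T (∫ x, u x • gradient ψ x) := by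
          rw [integral_comp_similarity hc O z (fun x => T (u x • gradient ψ x)), T.integral_comp_comm
            (integrable_smul_gradient hu.1 hψs hψc)]
      _ = - ((c ^ n)⁻¹ • T (∫ x, ψ x • g x)) := by
          rw [hu.2.2 ψ hψs hψc, map_neg, smul_neg]
      _ = - ∫ y, (fun x => T (ψ x • g x)) (c • O y + z) := by
          rw [integral_comp_similarity hc O z (fun x => T (ψ x • g x)), T.integral_comp_comm
            (integrable_testFunction_smul hu.2.1 hψs hψc)]
      _ = _ := by
          congr 2; ext1 y
          simp only [hφψ, map_smul, he, hTa, smul_comm c]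

theorem D1p.comp_similarity {u : Space n → ℝ} (hu : u ∈ D1p n p) {c : ℝ} (hc : 0 < c)
    (O : Space n ≃ₗᵢ[ℝ] Space n) (z : Space n) : (fun y => u (c • O y + z)) ∈ D1p n p := by
  obtain ⟨hu1, hu2, g, hg, hgm⟩ := hu
  refine ⟨by fun_prop, locallyIntegrable_comp_similarity hc O z hu2, _,
    hg.comp_similarity hc O z, ?_⟩
  have := memLp_comp_similarity hc O z hgm
  refine (this.of_le_mul (c := c) ?_ ?_)
  · exact (O.symm.continuous.comp_aestronglyMeasurable this.1).const_smul c
  · simp [norm_smul, abs_of_pos hc]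

/-- The chain rule gives the factor `c`, the change of variables the factor `c ^ (-n/p)`. -/
theorem fieldNorm_weakGradient_comp_similarity {u : Space n → ℝ} (hu : u ∈ D1p n p) (hp : 0 < p)
    {c : ℝ} (hc : 0 < c) (O : Space n ≃ₗᵢ[ℝ] Space n) (z : Space n) :
    fieldNorm p (weakGradient fun y => u (c • O y + z))
      = c ^ (1 - (n : ℝ) / p) * fieldNorm p (weakGradient u) := by
  have h := ((D1p.hasWeakGradient hu).comp_similarity hc O z).weakGradient_ae
  rw [fieldNorm, eLpNorm_congr_ae h, fieldNorm]
  have h2 : eLpNorm (fun y => c • O.symm (weakGradient u (c • O y + z))) (ENNReal.ofReal p) volume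
      = ENNReal.ofReal c *
        eLpNorm (fun y => weakGradient u (c • O y + z)) (ENNReal.ofReal p) volume := by
    rw [show (fun y => c • O.symm (weakGradient u (c • O y + z)))
      = c • fun y => O.symm (weakGradient u (c • O y + z)) from rfl, eLpNorm_const_smul,
      Real.enorm_of_nonneg hc.le]
    congr 1
    exact eLpNorm_congr_norm_ae (by simp)
  rw [h2, eLpNorm_comp_similarity hc O z hp, ← mul_assoc, ← ENNReal.ofReal_mul hc.le,
    ENNReal.toReal_mul, ENNReal.toReal_ofReal (by positivity), Real.rpow_sub hc, Real.rpow_one,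
    neg_div, Real.rpow_neg hc.le, div_eq_mul_inv c]

end Similarity

/-! ### Hölder's inequality for vector fields -/

section Holder

variable {α E : Type*} [MeasurableSpace α] {μ : Measure α} [NormedAddCommGroup E]
  [InnerProductSpace ℝ E] {p q : ℝ} {F G : α → E}

theorem eLpNorm_inner_le (hpq : p.HolderConjugate q) (hF : AEStronglyMeasurable F μ)
    (hG : AEStronglyMeasurable G μ) :
    eLpNorm (fun x => inner ℝ (F x) (G x)) 1 μ
      ≤ eLpNorm F (ENNReal.ofReal p) μ * eLpNorm G (ENNReal.ofReal q) μ := by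
  have := hpq.ennrealOfReal
  simpa using eLpNorm_le_eLpNorm_mul_eLpNorm'_of_norm (p := ENNReal.ofReal p)
    (q := ENNReal.ofReal q) (r := 1) hF hG (fun a b => inner ℝ a b) 1
    (.of_forall fun x => by simpa using norm_inner_le_norm (𝕜 := ℝ) (F x) (G x))

theorem integrable_inner_of_memLp (hpq : p.HolderConjugate q)
    (hF : MemLp F (ENNReal.ofReal p) μ) (hG : MemLp G (ENNReal.ofReal q) μ) :
    Integrable (fun x => inner ℝ (F x) (G x)) μ := by
  rw [← memLp_one_iff_integrable]
  exact ⟨hF.1.inner hG.1,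
    (eLpNorm_inner_le hpq hF.1 hG.1).trans_lt (ENNReal.mul_lt_top hF.2 hG.2)⟩

theorem abs_integral_inner_le (hpq : p.HolderConjugate q)
    (hF : MemLp F (ENNReal.ofReal p) μ) (hG : MemLp G (ENNReal.ofReal q) μ) :
    |∫ x, inner ℝ (F x) (G x) ∂μ|
      ≤ (eLpNorm F (ENNReal.ofReal p) μ).toReal * (eLpNorm G (ENNReal.ofReal q) μ).toReal := by
  calc |∫ x, inner ℝ (F x) (G x) ∂μ| ≤ ∫ x, ‖(inner ℝ (F x) (G x) : ℝ)‖ ∂μ :=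
        norm_integral_le_integral_norm (μ := μ) fun x => (inner ℝ (F x) (G x) : ℝ)
    _ = (eLpNorm (fun x => (inner ℝ (F x) (G x) : ℝ)) 1 μ).toReal := by
        rw [integral_norm_eq_lintegral_enorm (hF.1.inner hG.1), eLpNorm_one_eq_lintegral_enorm]
    _ ≤ _ := by
        rw [← ENNReal.toReal_mul]
        exact ENNReal.toReal_mono (ENNReal.mul_lt_top hF.2 hG.2).ne
          (eLpNorm_inner_le hpq hF.1 hG.1)

end Holder

/-! ### Morrey's inequality through dilated averages -/

/-- The dilation acts on the smooth factor, because `u` is only continuous and cannot be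
differentiated under the integral. -/
theorem hasDerivAt_integral_mul_comp_smul {u ψ : Space n → ℝ} (hu : Continuous u)
    (hψ : ContDiff ℝ ∞ ψ) (hc : HasCompactSupport ψ) :
    HasDerivAt (fun r : ℝ => ∫ y, u y * ψ (r • y)) (∫ y, u y * fderiv ℝ ψ y y) 1 := by
  obtain ⟨R, hR⟩ := hc.isCompact.isBounded.subset_closedBall 0
  obtain ⟨M, hM⟩ := (hc.fderiv (𝕜 := ℝ)).exists_bound_of_continuous
    (hψ.continuous_fderiv (by simp))
  have hfd := hψ.continuous_fderiv (by simp)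
  have hint : Integrable fun y => u y * ψ y :=
    (hu.mul hψ.continuous).integrable_of_hasCompactSupport hc.mul_left
  have key := hasDerivAt_integral_of_dominated_loc_of_deriv_le (μ := (volume : Measure (Space n)))
    (F := fun r : ℝ => fun y => u y * ψ (r • y))
    (F' := fun r : ℝ => fun y => u y * fderiv ℝ ψ (r • y) y) (x₀ := 1)
    -- For `r > 1/2` the point `r • y` leaves the ball of radius `R` containing the support of `ψ`
    -- as soon as `‖y‖ > 2R`.
    (bound := (Metric.closedBall (0 : Space n) (2 * R)).indicator
      fun y => |u y| * (M * (2 * R)))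
    (s := Set.Ioi (1 / 2)) (Ioi_mem_nhds (by norm_num)) ?_ ?_ ?_ ?_ ?_ ?_
  · simpa using key.2
  · exact .of_forall fun r => by
      have : Continuous fun y => u y * ψ (r • y) :=
        hu.mul (hψ.continuous.comp (continuous_const_smul r))
      exact this.aestronglyMeasurable
  · simpa using hint
  · have : Continuous fun y => u y * fderiv ℝ ψ ((1 : ℝ) • y) y :=
      hu.mul ((hfd.comp (continuous_const_smul _)).clm_apply continuous_id)
    exact this.aestronglyMeasurable
  · refine .of_forall fun y r hr => ?_
    have hr0 : (1 / 2 : ℝ) < r := hr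
    by_cases hy : y ∈ Metric.closedBall (0 : Space n) (2 * R)
    · rw [Set.indicator_of_mem hy, norm_mul, Real.norm_eq_abs]
      gcongr
      refine (ContinuousLinearMap.le_opNorm _ _).trans ?_
      have : ‖y‖ ≤ 2 * R := by simpa using hy
      exact mul_le_mul (hM _) this (norm_nonneg _) ((norm_nonneg _).trans (hM 0))
    · rw [Set.indicator_of_notMem hy]
      have hz : fderiv ℝ ψ (r • y) = 0 := by
        by_contra h0
        have h1 : r • y ∈ tsupport ψ := support_fderiv_subset ℝ h0
        have h2 := hR h1
        simp only [mem_closedBall_zero_iff, norm_smul, Real.norm_eq_abs,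
          abs_of_pos (by linarith : 0 < r)] at h2
        simp only [mem_closedBall_zero_iff, not_le] at hy
        nlinarith [norm_nonneg y]
      simp [hz]
  · rw [integrable_indicator_iff Metric.isClosed_closedBall.measurableSet]
    exact (hu.abs.mul continuous_const).continuousOn.integrableOn_compact
      (isCompact_closedBall _ _)
  · refine .of_forall fun y r _ => ?_
    have h1 : HasFDerivAt ψ (fderiv ℝ ψ (r • y)) (r • y) :=
      (hψ.differentiable (by simp) _).hasFDerivAt
    have h2 : HasDerivAt (fun r : ℝ => r • y) y r := by
      simpa using (hasDerivAt_id r).smul_const y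
    exact (h1.comp_hasDerivAt r h2).const_mul (u y)

/-- The left factor is the divergence of the field `y ↦ ψ(y) y`; the identity is the sum over `i` of
the `i`-th components of the weak gradient formula tested on `yᵢ ψ`. -/
theorem HasWeakGradient.integral_mul_divergence {u ψ : Space n → ℝ} {g : Space n → Space n}
    (hu : HasWeakGradient u g) (hψ : ContDiff ℝ ∞ ψ) (hc : HasCompactSupport ψ) :
    ∫ y, u y * (n * ψ y + fderiv ℝ ψ y y) = - ∫ y, inner ℝ (g y) y * ψ y := by
  let b := EuclideanSpace.basisFun (Fin n) ℝ
  let P : Fin n → Space n →L[ℝ] ℝ := fun i => EuclideanSpace.proj i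
  have hPb : ∀ i, P i (b i) = 1 := fun i => by simp [P, b]
  have hs : ∀ i, ContDiff ℝ ∞ fun y => P i y * ψ y := fun i => (P i).contDiff.mul hψ
  have hcs : ∀ i, HasCompactSupport fun y => P i y * ψ y := fun i => hc.mul_left
  have hgrad : ∀ i y, P i (gradient (fun y => P i y * ψ y) y)
      = ψ y + P i y * fderiv ℝ ψ y (b i) := by
    intro i y
    have h1 : P i (gradient (fun y => P i y * ψ y) y)
        = inner ℝ (gradient (fun y => P i y * ψ y) y) (b i) := by
      simp only [P, b, EuclideanSpace.basisFun_apply, EuclideanSpace.inner_single_right]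
      simp
    rw [h1, inner_gradient_left, fderiv_fun_mul (P i).differentiableAt
      (hψ.differentiable (by simp) _)]
    simp [hPb]
    ring
  have hi : ∀ i, ∫ y, u y * (ψ y + P i y * fderiv ℝ ψ y (b i))
      = - ∫ y, P i y * ψ y * P i (g y) := by
    intro i
    have h := congrArg (P i) (hu.2.2 _ (hs i) (hcs i))
    rw [map_neg, ← (P i).integral_comp_comm (integrable_smul_gradient hu.1 (hs i) (hcs i)),
      ← (P i).integral_comp_comm (integrable_testFunction_smul hu.2.1 (hs i) (hcs i))] at h
    simpa only [map_smul, smul_eq_mul, hgrad] using h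
  have hI1 : ∀ i, Integrable fun y => u y * (ψ y + P i y * fderiv ℝ ψ y (b i)) := fun i => by
    simpa only [map_smul, smul_eq_mul, hgrad] using
      (P i).integrable_comp (integrable_smul_gradient hu.1 (hs i) (hcs i))
  have hI2 : ∀ i, Integrable fun y => P i y * ψ y * P i (g y) := fun i => by
    simpa only [map_smul, smul_eq_mul] using
      (P i).integrable_comp (integrable_testFunction_smul hu.2.1 (hs i) (hcs i))
  have hy : ∀ y : Space n, y = ∑ i, P i y • b i := fun y => by
    simpa [P, b] using (b.sum_repr y).symm
  calc ∫ y, u y * (n * ψ y + fderiv ℝ ψ y y)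
      = ∫ y, ∑ i, u y * (ψ y + P i y * fderiv ℝ ψ y (b i)) := by
        congr 1; ext1 y
        conv_lhs => rw [show fderiv ℝ ψ y y = fderiv ℝ ψ y (∑ i, P i y • b i) by rw [← hy y]]
        simp [← Finset.mul_sum, Finset.sum_add_distrib]
    _ = - ∫ y, ∑ i, P i y * ψ y * P i (g y) := by
        rw [integral_finsetSum _ fun i _ => hI1 i, integral_finsetSum _ fun i _ => hI2 i,
          ← Finset.sum_neg_distrib]
        exact Finset.sum_congr rfl fun i _ => hi i
    _ = _ := by
        congr 2; ext1 y
        rw [PiLp.inner_apply, Finset.sum_mul]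
        refine Finset.sum_congr rfl fun i _ => ?_
        simp [P]
        ring

/-- Substituting `y = s z` turns the average into `s⁻ⁿ ∫ u(y) ψ(y/s) dy`, where only smooth factors
depend on `s`. The product rule at `s = 1` produces minus the integral of `u` against `div (ψ y)`.
-/
theorem HasWeakGradient.hasDerivAt_one {u ψ : Space n → ℝ} {g : Space n → Space n}
    (hu : HasWeakGradient u g) (hcu : Continuous u) (hψ : ContDiff ℝ ∞ ψ)
    (hc : HasCompactSupport ψ) :
    HasDerivAt (fun s : ℝ => ∫ z, u (s • z) * ψ z) (∫ z, inner ℝ (g z) z * ψ z) 1 := by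
  have h1 := hasDerivAt_integral_mul_comp_smul hcu hψ hc
  have h2 : HasDerivAt (fun s : ℝ => s⁻¹) (-1) 1 := by
    simpa using hasDerivAt_inv (one_ne_zero (α := ℝ))
  have h3 : HasDerivAt (fun s : ℝ => ∫ y, u y * ψ (s⁻¹ • y))
      ((∫ y, u y * fderiv ℝ ψ y y) * (-1)) 1 :=
    HasDerivAt.comp (h₂ := fun r : ℝ => ∫ y, u y * ψ (r • y)) (1 : ℝ) (by simpa using h1) h2
  have h4 : HasDerivAt (fun s : ℝ => (s⁻¹) ^ n) (n * (-1)) 1 := by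
    simpa using h2.fun_pow n
  have h5 := h4.mul h3
  have hI1 : Integrable fun y => u y * ψ y :=
    (hcu.mul hψ.continuous).integrable_of_hasCompactSupport hc.mul_left
  have hI2 : Integrable fun y => u y * fderiv ℝ ψ y y := by
    refine (hcu.mul ((hψ.continuous_fderiv (by simp)).clm_apply
      continuous_id)).integrable_of_hasCompactSupport (HasCompactSupport.mul_left ?_)
    refine (hc.fderiv (𝕜 := ℝ)).mono fun y hy h0 => hy ?_
    simp [h0]
  have hval : ((n : ℝ) * -1 * ∫ y, u y * ψ ((1 : ℝ)⁻¹ • y))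
      + (1 : ℝ)⁻¹ ^ n * ((∫ y, u y * fderiv ℝ ψ y y) * -1) = ∫ z, inner ℝ (g z) z * ψ z := by
    have h := hu.integral_mul_divergence hψ hc
    simp only [mul_add, mul_left_comm _ (n : ℝ)] at h
    rw [integral_add (hI1.const_mul _) hI2, integral_const_mul] at h
    simp only [inv_one, one_smul, one_pow, one_mul]
    linarith
  rw [← hval]
  refine h5.congr_of_eventuallyEq ?_
  filter_upwards [Ioi_mem_nhds (zero_lt_one' ℝ)] with s hs
  have hs0 : (0 : ℝ) < s := hs
  have := Measure.integral_comp_smul (volume : Measure (Space n)) (fun y => u y * ψ (s⁻¹ • y)) s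
  rw [finrank_euclideanSpace_fin, abs_of_pos (by positivity)] at this
  simpa [smul_smul, hs0.ne'] using this

theorem HasWeakGradient.hasDerivAt_dilate {u ψ : Space n → ℝ} {g : Space n → Space n}
    (hu : HasWeakGradient u g) (hcu : Continuous u) (hψ : ContDiff ℝ ∞ ψ)
    (hc : HasCompactSupport ψ) (x : Space n) {s : ℝ} (hs : 0 < s) :
    HasDerivAt (fun s : ℝ => ∫ z, u (s • z + x) * ψ z)
      (∫ z, inner ℝ (g (s • z + x)) (ψ z • z)) s := by
  have h1 := hu.comp_similarity hs (LinearIsometryEquiv.refl ℝ _) x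
  replace h1 : HasWeakGradient (fun y => u (s • y + x)) fun y => s • g (s • y + x) := h1
  have h2 := h1.hasDerivAt_one (by fun_prop) hψ hc
  have h3 : HasDerivAt (fun t : ℝ => t / s) (1 / s) s := (hasDerivAt_id s).div_const s
  have h4 := HasDerivAt.comp (h₂ := fun t : ℝ => ∫ z, u (s • t • z + x) * ψ z) s
    (by simpa [hs.ne'] using h2) h3
  have h5 : (fun t : ℝ => ∫ z, u (s • t • z + x) * ψ z) ∘ (fun t : ℝ => t / s)
      = fun s => ∫ z, u (s • z + x) * ψ z := by
    ext t
    simp [smul_smul, mul_div_cancel₀ _ hs.ne']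
  have h6 : (∫ z, inner ℝ (s • g (s • z + x)) z * ψ z) * (1 / s)
      = ∫ z, inner ℝ (g (s • z + x)) (ψ z • z) := by
    rw [← integral_mul_const]
    congr 1; ext z
    rw [inner_smul_left, inner_smul_right]
    simp
    field_simp
  rwa [h5, h6] at h4

theorem memLp_testFunction_smul_id {ψ : Space n → ℝ} (hψ : Continuous ψ)
    (hc : HasCompactSupport ψ) (r : ℝ≥0∞) : MemLp (fun z => ψ z • z) r volume :=
  (hψ.smul continuous_id).memLp_of_hasCompactSupport hc.smul_right

theorem abs_integral_inner_dilate_le {ψ : Space n → ℝ} {g : Space n → Space n}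
    (hpq : p.HolderConjugate q) (hg : MemLp g (ENNReal.ofReal p) volume)
    (hψ : Continuous ψ) (hc : HasCompactSupport ψ) (x : Space n) {s : ℝ} (hs : 0 < s) :
    |∫ z, inner ℝ (g (s • z + x)) (ψ z • z)|
      ≤ fieldNorm p g * fieldNorm q (fun z => ψ z • z) * s ^ (-(n : ℝ) / p) := by
  have h1 := memLp_comp_similarity hs (LinearIsometryEquiv.refl ℝ _) x hg
  refine (abs_integral_inner_le hpq h1 (memLp_testFunction_smul_id hψ hc _)).trans_eq ?_
  have h2 := eLpNorm_comp_similarity hs (LinearIsometryEquiv.refl ℝ _) x hpq.pos g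
  rw [h2, ENNReal.toReal_mul, ENNReal.toReal_ofReal (by positivity), fieldNorm, fieldNorm]
  ring

/-- The average at scale `s` tends to `u x` as `s → 0`, and its `s`-derivative is at most a constant
times `s ^ (-n/p)`, which is integrable on `(0, 1)` exactly because `n < p`. -/
theorem HasWeakGradient.abs_average_sub_le {u ψ : Space n → ℝ} {g : Space n → Space n}
    (hu : HasWeakGradient u g) (hcu : Continuous u) (hpq : p.HolderConjugate q)
    (hn : (n : ℝ) < p) (hg : MemLp g (ENNReal.ofReal p) volume)
    (hψ : ContDiff ℝ ∞ ψ) (hc : HasCompactSupport ψ) (h1 : ∫ z, ψ z = 1) (x : Space n) :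
    |(∫ z, u (z + x) * ψ z) - u x|
      ≤ fieldNorm p g * fieldNorm q (fun z => ψ z • z) / (1 - n / p) := by
  set A := fieldNorm p g * fieldNorm q (fun z => ψ z • z) with hA
  have hA0 : 0 ≤ A := mul_nonneg ENNReal.toReal_nonneg ENNReal.toReal_nonneg
  have hp := hpq.pos
  set a : ℝ := 1 - n / p with ha
  have ha0 : 0 < a := by rw [ha, sub_pos, div_lt_one hp]; exact hn
  set f : ℝ → ℝ := fun s => ∫ z, u (s • z + x) * ψ z with hf
  have hfc : Continuous f := by
    rw [← continuousOn_univ]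
    refine continuousOn_integral_of_compact_support hc.isCompact ?_ fun s z _ hz => ?_
    · refine Continuous.continuousOn ?_
      have := hψ.continuous
      simp only [Function.uncurry_def]
      fun_prop
    · simp [image_eq_zero_of_notMem_tsupport hz]
  have hf0 : f 0 = u x := by
    simp [hf, integral_const_mul, h1]
  have hf1 : f 1 = ∫ z, u (z + x) * ψ z := by simp [hf]
  -- The derivative is controlled only for `s > 0`, so the comparison with the antiderivative of the
  -- bound runs on `[ε, 1]` before `ε → 0`.
  have hε : ∀ ε ∈ Set.Ioo (0 : ℝ) 1, |f 1 - f ε| ≤ A / a := by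
    intro ε ⟨hε0, hε1⟩
    have hB : ∀ s ∈ Set.Icc ε 1, HasDerivAt (fun s : ℝ => A * (s ^ a - ε ^ a) / a)
        (A * s ^ (-(n : ℝ) / p)) s := by
      intro s hs
      have hs0 : 0 < s := hε0.trans_le hs.1
      have := ((((Real.hasDerivAt_rpow_const (p := a) (.inl hs0.ne')).sub_const
        (ε ^ a)).const_mul A).div_const a)
      rw [show a - 1 = -(n : ℝ) / p by rw [ha]; ring] at this
      rwa [show A * s ^ (-(n : ℝ) / p) = A * (a * s ^ (-(n : ℝ) / p)) / a by field_simp]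
    have key := image_norm_le_of_norm_deriv_right_le_deriv_boundary'
      (f := fun s => f s - f ε) (a := ε) (b := 1)
      (f' := fun s => ∫ z, inner ℝ (g (s • z + x)) (ψ z • z))
      (B := fun s : ℝ => A * (s ^ a - ε ^ a) / a) (B' := fun s => A * s ^ (-(n : ℝ) / p))
      (hfc.sub continuous_const).continuousOn
      (fun s hs => ((hu.hasDerivAt_dilate hcu hψ hc x (hε0.trans_le hs.1)).sub_const
        (f ε)).hasDerivWithinAt)
      (by simp) (fun s hs => (hB s hs).continuousAt.continuousWithinAt)
      (fun s hs => (hB s (Set.Ico_subset_Icc_self hs)).hasDerivWithinAt)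
      (fun s hs => abs_integral_inner_dilate_le hpq hg hψ.continuous hc x
        (hε0.trans_le hs.1)) (Set.right_mem_Icc.2 hε1.le)
    refine key.trans ?_
    have h3 : (0 : ℝ) ≤ ε ^ a := by positivity
    rw [Real.one_rpow]
    gcongr
    nlinarith
  rw [← hf1, ← hf0]
  have hlim : Filter.Tendsto (fun ε => |f 1 - f ε|) (nhdsWithin 0 (Set.Ioi 0))
      (nhds |f 1 - f 0|) :=
    ((continuous_const.sub hfc).abs.tendsto 0).mono_left nhdsWithin_le_nhds
  refine le_of_tendsto hlim ?_
  filter_upwards [Ioo_mem_nhdsGT (zero_lt_one' ℝ)] with ε h using hε ε h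

/-- Morrey's inequality: a continuous function deviates from one of its averages by at most the
`L^p` norm of its weak gradient, up to a factor of linear growth. -/
theorem exists_morrey_bound (hn : (n : ℝ) < p) (hpq : p.HolderConjugate q) :
    ∃ A : ℝ, 0 ≤ A ∧ ∀ u ∈ D1p n p, ∃ m : ℝ, ∀ x,
      |u x - m| ≤ A * (‖x‖ + 1) * fieldNorm p (weakGradient u) := by
  have hp := hpq.pos
  have ha0 : 0 < 1 - (n : ℝ) / p := by rw [sub_pos, div_lt_one hp]; exact hn
  let φ : ContDiffBump (0 : Space n) := ⟨1 / 2, 1, by norm_num, by norm_num⟩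
  let η : Space n → ℝ := φ.normed volume
  have hη : ContDiff ℝ ∞ η := φ.contDiff_normed
  have hηc : HasCompactSupport η := φ.hasCompactSupport_normed
  have hη1 : ∫ z, η z = 1 := φ.integral_normed
  have hηL : MemLp η (ENNReal.ofReal q) volume := hη.continuous.memLp_of_hasCompactSupport hηc
  set N := (eLpNorm η (ENNReal.ofReal q) volume).toReal
  refine ⟨N / (1 - n / p), by positivity, fun u hu => ⟨∫ z, u z * η z, fun x => ?_⟩⟩
  set e := Homeomorph.addRight x
  -- Translating the kernel along with `u` makes the average `∫ u η`, independent of `x`. The price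
  -- is the factor `‖z‖ ≤ ‖x‖ + 1` on the support of the translated kernel.
  have hψ : ContDiff ℝ ∞ fun z => η (z + x) := hη.comp (contDiff_id.add contDiff_const)
  have hψc : HasCompactSupport fun z => η (z + x) := hηc.comp_homeomorph e
  have h1 := (D1p.hasWeakGradient hu).abs_average_sub_le hu.1 hpq hn (D1p.memLp hu) hψ hψc
    ((integral_add_right_eq_self η x).trans hη1) x
  rw [integral_add_right_eq_self (fun z => u z * η z) x] at h1
  rw [abs_sub_comm]
  refine h1.trans ?_
  have h2 : fieldNorm q (fun z => η (z + x) • z) ≤ (‖x‖ + 1) * N := by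
    have hm : eLpNorm (fun z => η (z + x)) (ENNReal.ofReal q) volume
        = eLpNorm η (ENNReal.ofReal q) volume :=
      eLpNorm_comp_measurePreserving (g := η) hηL.1 (measurePreserving_add_right volume x)
    have hle : eLpNorm (fun z => η (z + x) • z) (ENNReal.ofReal q) volume
        ≤ ENNReal.ofReal (‖x‖ + 1) * eLpNorm (fun z => η (z + x)) (ENNReal.ofReal q) volume := by
      refine eLpNorm_le_mul_eLpNorm_of_ae_le_mul (.of_forall fun z => ?_) _
      rw [norm_smul, mul_comm]
      by_cases hz : η (z + x) = 0
      · simp [hz]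
      · gcongr
        have hz1 : z + x ∈ Metric.ball (0 : Space n) 1 := by
          have : z + x ∈ Function.support η := hz
          rwa [φ.support_normed_eq] at this
        have h3 : ‖z‖ ≤ ‖z + x‖ + ‖x‖ := by simpa using norm_sub_le (z + x) x
        have h4 : ‖z + x‖ < 1 := by simpa using hz1
        linarith
    rw [hm] at hle
    calc fieldNorm q (fun z => η (z + x) • z)
        ≤ (ENNReal.ofReal (‖x‖ + 1) * eLpNorm η (ENNReal.ofReal q) volume).toReal :=
          ENNReal.toReal_mono (ENNReal.mul_lt_top ENNReal.ofReal_lt_top hηL.2).ne hle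
      _ = _ := by rw [ENNReal.toReal_mul, ENNReal.toReal_ofReal (by positivity)]
  calc _ ≤ fieldNorm p (weakGradient u) * ((‖x‖ + 1) * N) / (1 - n / p) := by
        gcongr
        exact ENNReal.toReal_nonneg
    _ = _ := by ring

/-! ### Riesz representation for vector-valued `L^p` -/

section LpDuality

open Filter Topology
open scoped NNReal

variable {α E : Type*} [MeasurableSpace α] {μ : Measure α} [NormedAddCommGroup E]

section Indicator

variable {r : ℝ≥0∞} [Fact (1 ≤ r)]

/-- Partial sums are indicators of finite unions, whose measures exhaust that of the whole union;
for `r ≠ ⊤` this forces convergence in `L^r`. It supplies the countable additivity of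
`functionalMeasure`. -/
theorem hasSum_indicatorConstLp [IsFiniteMeasure μ] (hr : r ≠ ⊤) {f : ℕ → Set α}
    (hf : ∀ i, MeasurableSet (f i)) (hd : Pairwise (Function.onFun Disjoint f)) (c : E) :
    HasSum (fun i => indicatorConstLp r (hf i) (measure_ne_top μ _) c)
      (indicatorConstLp r (MeasurableSet.iUnion hf) (measure_ne_top μ _) c) := by
  have hfin : ∀ s : Finset ℕ, ∑ i ∈ s, indicatorConstLp r (hf i) (measure_ne_top μ _) c
      = indicatorConstLp r (s.measurableSet_biUnion fun i _ => hf i) (measure_ne_top μ _) c := by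
    intro s
    induction s using Finset.induction_on with
    | empty => simp
    | insert a s ha ih =>
      rw [Finset.sum_insert ha, ih, ← indicatorConstLp_disjoint_union]
      · congr 1
        simp
      · simp only [Set.disjoint_iUnion_right]
        intro i hi
        exact hd (fun h => ha (h ▸ hi))
  unfold HasSum
  simp only [hfin]
  refine tendsto_indicatorConstLp_set hr ?_
  have h1 : Tendsto (fun s : Finset ℕ => ∑ i ∈ s, μ (f i)) atTop (𝓝 (μ (⋃ i, f i))) := by
    rw [measure_iUnion hd hf]
    exact ENNReal.summable.hasSum
  have h2 := ENNReal.Tendsto.sub (tendsto_const_nhds (x := μ (⋃ i, f i))) h1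
    (.inl (measure_ne_top μ _))
  rw [tsub_self] at h2
  refine h2.congr fun s => ?_
  have hsub : (⋃ i ∈ s, f i) ⊆ ⋃ i, f i := Set.iUnion₂_subset fun i _ => Set.subset_iUnion f i
  rw [symmDiff_of_le hsub, measure_sdiff hsub
    (s.measurableSet_biUnion fun i _ => hf i).nullMeasurableSet (measure_ne_top μ _),
    measure_biUnion_finset (fun i _ j _ hij => hd hij) fun i _ => hf i]

variable [NormedSpace ℝ E]

theorem lp_clm_ext_indicator (hr : r ≠ ⊤) {Φ Ψ : Lp E r μ →L[ℝ] ℝ}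
    (h : ∀ (s : Set α) (hs : MeasurableSet s) (hμ : μ s ≠ ⊤) (c : E),
      Φ (indicatorConstLp r hs hμ c) = Ψ (indicatorConstLp r hs hμ c)) : Φ = Ψ := by
  ext f
  induction f using Lp.induction hr with
  | indicatorConst c hs hμ =>
    rw [Lp.simpleFunc.coe_indicatorConst]
    exact h _ hs hμ.ne c
  | add hf hg _ h1 h2 => rw [map_add, map_add, h1, h2]
  | isClosed => exact isClosed_eq Φ.continuous Ψ.continuous

open scoped Classical in
/-- The signed measure `s ↦ Λ (c 1_s)` attached to a functional on `L^r` of a finite measure. -/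
def functionalMeasure [IsFiniteMeasure μ] (hr : r ≠ ⊤) (Λ : Lp E r μ →L[ℝ] ℝ) (c : E) :
    SignedMeasure α where
  measureOf' s := if hs : MeasurableSet s then
    Λ (indicatorConstLp r hs (measure_ne_top μ _) c) else 0
  empty' := by simp
  not_measurable' s hs := dif_neg hs
  m_iUnion' f hf hd := by
    simp only [hf, MeasurableSet.iUnion hf, dif_pos]
    exact (hasSum_indicatorConstLp hr hf hd c).mapL Λ

theorem functionalMeasure_apply [IsFiniteMeasure μ] (hr : r ≠ ⊤) (Λ : Lp E r μ →L[ℝ] ℝ) (c : E)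
    {s : Set α} (hs : MeasurableSet s) :
    functionalMeasure hr Λ c s = Λ (indicatorConstLp r hs (measure_ne_top μ _) c) :=
  dif_pos hs

/-- Indicators of null sets vanish in `L^r`, so the measure attached to `Λ` is absolutely continuous
and Radon–Nikodym applies. -/
theorem exists_density_apply_indicatorConstLp [IsFiniteMeasure μ] (hr : r ≠ ⊤)
    (Λ : Lp E r μ →L[ℝ] ℝ) (c : E) : ∃ g : α → ℝ, Integrable g μ ∧
      ∀ (s : Set α) (hs : MeasurableSet s),
        Λ (indicatorConstLp r hs (measure_ne_top μ _) c) = ∫ x in s, g x ∂μ := by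
  have hac : functionalMeasure hr Λ c ≪ᵥ μ.toENNRealVectorMeasure := by
    refine VectorMeasure.AbsolutelyContinuous.mk fun s hs h0 => ?_
    rw [Measure.toENNRealVectorMeasure_apply_measurable hs] at h0
    rw [functionalMeasure_apply hr Λ c hs]
    have : indicatorConstLp r hs (measure_ne_top μ s) c = 0 := by
      rw [← norm_eq_zero, norm_indicatorConstLp (one_pos.trans_le Fact.out).ne' hr,
        measureReal_def, h0]
      have : 0 < r.toReal := ENNReal.toReal_pos (one_pos.trans_le Fact.out).ne' hr
      simp [Real.zero_rpow (inv_pos.2 this).ne']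
    rw [this, map_zero]
  refine ⟨(functionalMeasure hr Λ c).rnDeriv μ, SignedMeasure.integrable_rnDeriv _ _,
    fun s hs => ?_⟩
  rw [← functionalMeasure_apply hr Λ c hs, ← withDensityᵥ_apply
    (SignedMeasure.integrable_rnDeriv _ _) hs, SignedMeasure.withDensityᵥ_rnDeriv_eq _ _ hac]

/-- Multiplication by the indicator of a measurable set, as an operator on `L^r`. -/
def cutoff (r : ℝ≥0∞) [Fact (1 ≤ r)] {A : Set α} (hA : MeasurableSet A) :
    Lp E r μ →L[ℝ] Lp E r μ :=
  LinearMap.mkContinuous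
    { toFun := fun f => ((Lp.memLp f).indicator hA).toLp _
      map_add' := fun f g => by
        rw [← MemLp.toLp_add]
        refine MemLp.toLp_congr _ _ ?_
        filter_upwards [Lp.coeFn_add f g] with x hx
        by_cases hxA : x ∈ A
        · simpa only [Pi.add_apply, Set.indicator_of_mem hxA] using hx
        · simp [hxA]
      map_smul' := fun c f => by
        rw [RingHom.id_apply, ← MemLp.toLp_const_smul]
        refine MemLp.toLp_congr _ _ ?_
        filter_upwards [Lp.coeFn_smul c f] with x hx
        by_cases hxA : x ∈ A
        · simpa only [Pi.smul_apply, Set.indicator_of_mem hxA] using hx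
        · simp [hxA] } 1 fun f => by
    rw [one_mul]
    refine Lp.norm_le_norm_of_ae_le ?_
    filter_upwards [((Lp.memLp f).indicator hA).coeFn_toLp] with x hx
    refine (congrArg norm hx).trans_le ?_
    exact norm_indicator_le_norm_self _ _

theorem coeFn_cutoff {A : Set α} (hA : MeasurableSet A) (f : Lp E r μ) :
    cutoff r hA f =ᵐ[μ] A.indicator f :=
  ((Lp.memLp f).indicator hA).coeFn_toLp

end Indicator

variable [InnerProductSpace ℝ E] {p q : ℝ} [Fact (1 ≤ ENNReal.ofReal p)]

/-- The functional `G ↦ ∫ ⟨G, F⟩` on `L^p` given by a field `F ∈ L^q`. -/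
def pairing (hpq : p.HolderConjugate q) {F : α → E} (hF : MemLp F (ENNReal.ofReal q) μ) :
    Lp E (ENNReal.ofReal p) μ →L[ℝ] ℝ :=
  LinearMap.mkContinuous
    { toFun := fun G => ∫ x, inner ℝ (G x) (F x) ∂μ
      map_add' := fun G H => by
        rw [← integral_add (integrable_inner_of_memLp hpq (Lp.memLp G) hF)
          (integrable_inner_of_memLp hpq (Lp.memLp H) hF)]
        refine integral_congr_ae ?_
        filter_upwards [Lp.coeFn_add G H] with x hx
        rw [hx, Pi.add_apply, inner_add_left]
      map_smul' := fun c G => by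
        rw [RingHom.id_apply, ← integral_smul]
        refine integral_congr_ae ?_
        filter_upwards [Lp.coeFn_smul c G] with x hx
        rw [hx, Pi.smul_apply, inner_smul_left]
        simp } (eLpNorm F (ENNReal.ofReal q) μ).toReal fun G => by
    rw [mul_comm]
    exact abs_integral_inner_le hpq (Lp.memLp G) hF

theorem pairing_apply (hpq : p.HolderConjugate q) {F : α → E}
    (hF : MemLp F (ENNReal.ofReal q) μ) (G : Lp E (ENNReal.ofReal p) μ) :
    pairing hpq hF G = ∫ x, inner ℝ (G x) (F x) ∂μ := rfl

theorem integral_inner_indicatorConstLp (r : ℝ≥0∞) (F : α → E) {s : Set α}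
    (hs : MeasurableSet s) (hμ : μ s ≠ ⊤) (c : E) :
    ∫ x, inner ℝ (indicatorConstLp r hs hμ c x) (F x) ∂μ = ∫ x in s, inner ℝ c (F x) ∂μ := by
  rw [← integral_indicator hs]
  refine integral_congr_ae ?_
  filter_upwards [indicatorConstLp_coeFn (p := r) (hs := hs) (hμs := hμ) (c := c)] with x hx
  rw [hx]
  by_cases h : x ∈ s <;> simp [h]

theorem pairing_indicatorConstLp (hpq : p.HolderConjugate q) {F : α → E}
    (hF : MemLp F (ENNReal.ofReal q) μ) {s : Set α} (hs : MeasurableSet s) (hμ : μ s ≠ ⊤) (c : E) :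
    pairing hpq hF (indicatorConstLp _ hs hμ c) = ∫ x in s, inner ℝ c (F x) ∂μ :=
  integral_inner_indicatorConstLp _ F hs hμ c

theorem exists_vector_density [FiniteDimensional ℝ E] [IsFiniteMeasure μ]
    (Λ : Lp E (ENNReal.ofReal p) μ →L[ℝ] ℝ) :
    ∃ g : α → E, Integrable g μ ∧ ∀ (s : Set α) (hs : MeasurableSet s) (c : E),
      Λ (indicatorConstLp _ hs (measure_ne_top μ _) c) = ∫ x in s, inner ℝ c (g x) ∂μ := by
  let b := stdOrthonormalBasis ℝ E
  choose g hgi hg using fun i => exists_density_apply_indicatorConstLp ENNReal.ofReal_ne_top Λ (b i)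
  refine ⟨fun x => ∑ i, g i x • b i, integrable_finsetSum _ fun i _ => (hgi i).smul_const _,
    fun s hs c => ?_⟩
  let ι : E →ₗ[ℝ] Lp E (ENNReal.ofReal p) μ :=
    { toFun := fun c => indicatorConstLp _ hs (measure_ne_top μ _) c
      map_add' := fun c d => indicatorConstLp_add.symm
      map_smul' := fun a c => by
        simp only [indicatorConstLp, RingHom.id_apply, ← MemLp.toLp_const_smul]
        refine MemLp.toLp_congr _ _ (.of_forall fun x => ?_)
        by_cases h : x ∈ s <;> simp [h] }
  have h1 : ∀ c, ι c = indicatorConstLp _ hs (measure_ne_top μ _) c := fun c => rfl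
  have h2 : Λ (ι c) = ∑ i, inner ℝ (b i) c * Λ (ι (b i)) := by
    conv_lhs => rw [← b.sum_repr' c]
    rw [map_sum, map_sum]
    exact Finset.sum_congr rfl fun i _ => by rw [map_smul, map_smul, smul_eq_mul]
  rw [← h1, h2]
  simp only [h1, hg, inner_sum, inner_smul_right]
  rw [integral_finsetSum _ fun i _ => ((hgi i).mul_const _).integrableOn]
  refine Finset.sum_congr rfl fun i _ => ?_
  rw [integral_mul_const, mul_comm, real_inner_comm]

/-- The density `g` is a priori only integrable. On the sets where `‖g‖ ≤ k` it is bounded, hence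
represents `Λ` there, and testing with the Hölder extremal bounds its `L^q` norm by `‖Λ‖`. Fatou's
lemma carries the bound to `g`. -/
theorem exists_representation_of_isFiniteMeasure [FiniteDimensional ℝ E] [IsFiniteMeasure μ]
    (hpq : p.HolderConjugate q) (Λ : Lp E (ENNReal.ofReal p) μ →L[ℝ] ℝ) :
    ∃ (F : α → E) (hF : MemLp F (ENNReal.ofReal q) μ),
      eLpNorm F (ENNReal.ofReal q) μ ≤ ENNReal.ofReal ‖Λ‖ ∧ Λ = pairing hpq hF := by
  obtain ⟨g', hg'i, hg'⟩ := exists_vector_density Λ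
  obtain ⟨g, hgm, hgg⟩ : ∃ g, StronglyMeasurable g ∧ g' =ᵐ[μ] g := hg'i.1
  have hg : ∀ (s : Set α) (hs : MeasurableSet s) (c : E),
      Λ (indicatorConstLp _ hs (measure_ne_top μ _) c) = ∫ x in s, inner ℝ c (g x) ∂μ := by
    intro s hs c
    rw [hg' s hs c]
    refine setIntegral_congr_ae hs ?_
    filter_upwards [hgg] with x hx _
    rw [hx]
  have hp := hpq.pos
  have hq := hpq.symm.pos
  let A : ℕ → Set α := fun k => {x | ‖g x‖ ≤ k}
  have hA : ∀ k, MeasurableSet (A k) := fun k =>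
    measurableSet_le hgm.norm.measurable measurable_const
  have hgA : ∀ k, MemLp ((A k).indicator g) (ENNReal.ofReal q) μ := fun k => by
    refine MemLp.of_bound (hgm.indicator (hA k)).aestronglyMeasurable k (.of_forall fun x => ?_)
    by_cases h : x ∈ A k
    · rw [Set.indicator_of_mem h]
      exact h
    · simp [h]
  have hΛA : ∀ k, Λ.comp (cutoff _ (hA k)) = pairing hpq (hgA k) := by
    intro k
    refine lp_clm_ext_indicator ENNReal.ofReal_ne_top fun s hs hμ c => ?_
    rw [pairing_indicatorConstLp]
    have h1 : cutoff _ (hA k) (indicatorConstLp (ENNReal.ofReal p) hs hμ c)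
        = indicatorConstLp _ (hs.inter (hA k)) (measure_ne_top μ _) c := by
      ext1
      filter_upwards [coeFn_cutoff (hA k) (indicatorConstLp (ENNReal.ofReal p) hs hμ c),
        indicatorConstLp_coeFn (p := ENNReal.ofReal p) (hs := hs) (hμs := hμ) (c := c),
        indicatorConstLp_coeFn (p := ENNReal.ofReal p) (hs := hs.inter (hA k))
          (hμs := measure_ne_top μ _) (c := c)] with x h1 h2 h3
      rw [h1, h3, Set.inter_comm, ← Set.indicator_indicator]
      by_cases h : x ∈ A k <;> simp [h, h2]
    rw [ContinuousLinearMap.comp_apply, h1, hg, ← setIntegral_indicator (hA k)]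
    congr 1; ext x
    by_cases h : x ∈ A k <;> simp [h]
  have hbound : ∀ k, eLpNorm ((A k).indicator g) (ENNReal.ofReal q) μ ≤ ENNReal.ofReal ‖Λ‖ := by
    intro k
    set f := (A k).indicator g with hf
    have hfn : ∀ x, ‖f x‖ ≤ k := fun x => by
      by_cases h : x ∈ A k
      · rw [hf, Set.indicator_of_mem h]
        exact h
      · simp [hf, h]
    -- The equality case of Hölder: `‖φ‖ ^ p = ‖f‖ ^ q` and `⟨φ, f⟩ = ‖f‖ ^ q`. For `q < 2` zeros of
    -- `f` are harmless, since the factor `f x` kills the term.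
    let φ : α → E := fun x => ‖f x‖ ^ (q - 2) • f x
    have hfm : StronglyMeasurable f := hgm.indicator (hA k)
    have hφn : ∀ x, ‖φ x‖ = ‖f x‖ ^ (q - 1) := fun x => by
      by_cases h0 : f x = 0
      · simp [φ, h0, Real.zero_rpow (sub_ne_zero.2 hpq.symm.lt.ne')]
      · have : 0 < ‖f x‖ := norm_pos_iff.2 h0
        rw [norm_smul, Real.norm_of_nonneg (by positivity), ← Real.rpow_add_one this.ne']
        congr 1; ring
    have hφ : MemLp φ (ENNReal.ofReal p) μ := by
      refine MemLp.of_bound ?_ ((k : ℝ) ^ (q - 1)) (.of_forall fun x => ?_)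
      · exact ((hfm.norm.measurable.pow_const _).stronglyMeasurable.smul hfm).aestronglyMeasurable
      · rw [hφn]
        exact Real.rpow_le_rpow (norm_nonneg _) (hfn x) (sub_nonneg.2 hpq.symm.lt.le)
    set I := ∫⁻ x, ‖f x‖ₑ ^ q ∂μ with hI
    have hfq : eLpNorm f (ENNReal.ofReal q) μ = I ^ (1 / q) := by
      rw [eLpNorm_eq_lintegral_rpow_enorm_toReal (by simpa using hq) ENNReal.ofReal_ne_top,
        ENNReal.toReal_ofReal hq.le]
    have hφe : ∀ x, ‖φ x‖ₑ ^ p = ‖f x‖ₑ ^ q := fun x => by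
      rw [← ofReal_norm, hφn, ← ofReal_norm, ENNReal.ofReal_rpow_of_nonneg (by positivity) hp.le,
        ENNReal.ofReal_rpow_of_nonneg (norm_nonneg _) hq.le, ← Real.rpow_mul (norm_nonneg _)]
      congr 2
      exact hpq.symm.sub_one_mul_conj
    have hφp : eLpNorm φ (ENNReal.ofReal p) μ = I ^ (1 / p) := by
      rw [eLpNorm_eq_lintegral_rpow_enorm_toReal (by simpa using hp) ENNReal.ofReal_ne_top,
        ENNReal.toReal_ofReal hp.le]
      simp only [hφe, hI]
    have hIfin : I ≠ ⊤ := by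
      intro h
      have h2 := (hgA k).2
      rw [hfq, h, ENNReal.top_rpow_of_pos (by positivity)] at h2
      exact lt_irrefl _ h2
    have hval : Λ (cutoff _ (hA k) (hφ.toLp φ)) = I.toReal := by
      rw [← ContinuousLinearMap.comp_apply, hΛA, pairing_apply, hI,
        ← integral_toReal (hfm.enorm.pow_const _).aemeasurable
          (.of_forall fun x => ENNReal.rpow_lt_top_of_nonneg hq.le enorm_ne_top)]
      refine integral_congr_ae ?_
      filter_upwards [hφ.coeFn_toLp] with x hx
      rw [hx, inner_smul_left, real_inner_self_eq_norm_sq, ← ENNReal.toReal_rpow, toReal_enorm]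
      by_cases h0 : f x = 0
      · simp [h0, Real.zero_rpow hq.ne']
      · have : 0 < ‖f x‖ := norm_pos_iff.2 h0
        rw [RCLike.conj_to_real, ← Real.rpow_natCast, ← Real.rpow_add this]
        congr 1; push_cast; ring
    have hle : I.toReal ≤ ‖Λ‖ * (I ^ (1 / p)).toReal := by
      rw [← hval, ← hφp, ← Lp.norm_toLp φ hφ]
      refine (le_abs_self _).trans ((Λ.le_opNorm _).trans ?_)
      gcongr
      refine (ContinuousLinearMap.le_opNorm _ _).trans ?_
      refine (mul_le_mul_of_nonneg_right (LinearMap.mkContinuous_norm_le _ zero_le_one _)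
        (norm_nonneg _)).trans_eq (one_mul _)
    rw [hfq]
    refine (ENNReal.le_ofReal_iff_toReal_le
      (ENNReal.rpow_ne_top_of_nonneg (by positivity) hIfin) (norm_nonneg Λ)).2 ?_
    rw [← ENNReal.toReal_rpow]
    rw [← ENNReal.toReal_rpow] at hle
    -- When `I ≠ 0`, dividing `I ≤ ‖Λ‖ I ^ (1/p)` by `I ^ (1/p)` leaves `I ^ (1/q) ≤ ‖Λ‖`.
    rcases (ENNReal.toReal_nonneg (a := I)).eq_or_lt' with h0 | h0
    · rw [h0, Real.zero_rpow (by positivity)]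
      exact norm_nonneg Λ
    · refine le_of_mul_le_mul_right (a := I.toReal ^ (1 / p)) ?_ (Real.rpow_pos_of_pos h0 (1 / p))
      refine le_trans (le_of_eq ?_) hle
      rw [← Real.rpow_add h0, one_div, one_div, add_comm, hpq.inv_add_inv_eq_one, Real.rpow_one]
  have hgle : eLpNorm g (ENNReal.ofReal q) μ ≤ ENNReal.ofReal ‖Λ‖ := by
    refine (Lp.eLpNorm_lim_le_liminf_eLpNorm (f := fun k => (A k).indicator g)
      (fun k => (hgA k).1) g (.of_forall fun x => ?_)).trans ?_
    · refine tendsto_const_nhds.congr' ?_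
      filter_upwards [eventually_ge_atTop ⌈‖g x‖⌉₊] with k hk
      have : x ∈ A k := Nat.ceil_le.1 hk
      simp [this]
    · refine (liminf_le_liminf (.of_forall hbound)).trans_eq ?_
      simp
  have hgL : MemLp g (ENNReal.ofReal q) μ :=
    ⟨hgm.aestronglyMeasurable, hgle.trans_lt ENNReal.ofReal_lt_top⟩
  refine ⟨g, hgL, hgle, lp_clm_ext_indicator ENNReal.ofReal_ne_top fun s hs hμ c => ?_⟩
  rw [pairing_indicatorConstLp, hg]

theorem eLpNorm_rpow_smul_eq_withDensity {ρ : α → ℝ≥0} (hρ : Measurable ρ) {r : ℝ} (hr : 0 < r)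
    (f : α → E) : eLpNorm (fun x => ((ρ x : ℝ) ^ (1 / r)) • f x) (ENNReal.ofReal r) μ
      = eLpNorm f (ENNReal.ofReal r) (μ.withDensity fun x => (ρ x : ℝ≥0∞)) := by
  rw [eLpNorm_eq_lintegral_rpow_enorm_toReal (by simpa using hr) ENNReal.ofReal_ne_top,
    eLpNorm_eq_lintegral_rpow_enorm_toReal (by simpa using hr) ENNReal.ofReal_ne_top,
    ENNReal.toReal_ofReal hr.le, lintegral_withDensity_eq_lintegral_mul_non_measurable _
      hρ.coe_nnreal_ennreal (.of_forall fun _ => ENNReal.coe_lt_top)]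
  congr 2; ext x
  rw [enorm_smul, ENNReal.mul_rpow_of_nonneg _ _ hr.le, Pi.mul_apply]
  congr 1
  rw [Real.enorm_of_nonneg (by positivity), ENNReal.ofReal_rpow_of_nonneg (by positivity) hr.le,
    ← Real.rpow_mul (by positivity), one_div_mul_cancel hr.ne', Real.rpow_one,
    ENNReal.ofReal_coe_nnreal]

/-- The Riesz representation theorem for `L^p` spaces of fields with values in a Euclidean space:
every bounded functional on `L^p` is given by a field in `L^q`. -/
theorem exists_representation [FiniteDimensional ℝ E] [SigmaFinite μ]
    (hpq : p.HolderConjugate q) (Λ : Lp E (ENNReal.ofReal p) μ →L[ℝ] ℝ) :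
    ∃ (F : α → E) (hF : MemLp F (ENNReal.ofReal q) μ),
      eLpNorm F (ENNReal.ofReal q) μ ≤ ENNReal.ofReal ‖Λ‖ ∧ Λ = pairing hpq hF := by
  have hp := hpq.pos
  have hq := hpq.symm.pos
  -- A positive integrable weight reduces to a finite measure: `f ↦ ρ ^ (1/r) f` is an isometry from
  -- `L^r(ρ μ)` to `L^r(μ)`.
  obtain ⟨ρ, hρ0, hρm, hρi⟩ := exists_pos_lintegral_lt_of_sigmaFinite μ one_ne_zero
  set μ' := μ.withDensity fun x => (ρ x : ℝ≥0∞) with hμ'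
  have hfin : IsFiniteMeasure μ' := isFiniteMeasure_withDensity (hρi.trans ENNReal.one_lt_top).ne
  have hac : μ ≪ μ' := withDensity_absolutelyContinuous' hρm.coe_nnreal_ennreal.aemeasurable
    (.of_forall fun x => by simpa using (hρ0 x).ne')
  have hac' : μ' ≪ μ := withDensity_absolutelyContinuous _ _
  have hw : ∀ t : ℝ, Measurable fun x => (ρ x : ℝ) ^ t := fun t =>
    hρm.coe_nnreal_real.pow_const t
  have hT : ∀ {r : ℝ} (_ : 0 < r) {f : α → E}, MemLp f (ENNReal.ofReal r) μ' →
      MemLp (fun x => ((ρ x : ℝ) ^ (1 / r)) • f x) (ENNReal.ofReal r) μ := by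
    intro r hr f hf
    refine ⟨(hw _).aestronglyMeasurable.smul (hf.1.mono_ac hac), ?_⟩
    rw [eLpNorm_rpow_smul_eq_withDensity hρm hr]
    exact hf.2
  let T : Lp E (ENNReal.ofReal p) μ' →L[ℝ] Lp E (ENNReal.ofReal p) μ :=
    LinearMap.mkContinuous
      { toFun := fun f => (hT hp (Lp.memLp f)).toLp _
        map_add' := fun f g => by
          rw [← MemLp.toLp_add]
          refine MemLp.toLp_congr _ _ ?_
          filter_upwards [hac.ae_eq (Lp.coeFn_add f g)] with x hx
          rw [hx, Pi.add_apply, Pi.add_apply, smul_add]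
        map_smul' := fun c f => by
          rw [RingHom.id_apply, ← MemLp.toLp_const_smul]
          refine MemLp.toLp_congr _ _ ?_
          filter_upwards [hac.ae_eq (Lp.coeFn_smul c f)] with x hx
          rw [hx, Pi.smul_apply, Pi.smul_apply, smul_comm c] } 1 fun f => by
      refine (Lp.norm_toLp _ (hT hp (Lp.memLp f))).trans_le ?_
      rw [one_mul, Lp.norm_def, eLpNorm_rpow_smul_eq_withDensity hρm hp]
  obtain ⟨g, hg, hgle, hgΛ⟩ := exists_representation_of_isFiniteMeasure hpq (Λ.comp T)
  refine ⟨fun x => ((ρ x : ℝ) ^ (1 / q)) • g x, hT hq hg, ?_, ?_⟩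
  · rw [eLpNorm_rpow_smul_eq_withDensity hρm hq]
    refine hgle.trans (ENNReal.ofReal_le_ofReal ?_)
    refine (ContinuousLinearMap.opNorm_comp_le _ _).trans ?_
    exact mul_le_of_le_one_right (norm_nonneg _) (LinearMap.mkContinuous_norm_le _ zero_le_one _)
  · ext G
    have hpos : ∀ x, (0 : ℝ) < ρ x := fun x => hρ0 x
    have hG : ∀ x, ((ρ x : ℝ) ^ (1 / p)) • ((ρ x : ℝ) ^ (-(1 / p))) • G x = G x := fun x => by
      rw [smul_smul, ← Real.rpow_add (hpos x), add_neg_cancel, Real.rpow_zero, one_smul]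
    have hS : MemLp (fun x => ((ρ x : ℝ) ^ (-(1 / p))) • G x) (ENNReal.ofReal p) μ' := by
      refine ⟨((hw _).aestronglyMeasurable.smul (Lp.memLp G).1).mono_ac hac', ?_⟩
      rw [← eLpNorm_rpow_smul_eq_withDensity hρm hp]
      simp only [hG]
      exact (Lp.memLp G).2
    have hTS : T (hS.toLp _) = G := by
      ext1
      have h1 : T (hS.toLp _) =ᵐ[μ] fun x => ((ρ x : ℝ) ^ (1 / p)) • (hS.toLp _) x :=
        (hT hp (Lp.memLp (hS.toLp _))).coeFn_toLp
      filter_upwards [h1, hac.ae_eq hS.coeFn_toLp] with x h1 h2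
      rw [h1, h2, hG]
    have h2 := DFunLike.congr_fun hgΛ (hS.toLp _)
    rw [ContinuousLinearMap.comp_apply, hTS, pairing_apply] at h2
    rw [h2, pairing_apply]
    have h3 : ∫ x, inner ℝ (hS.toLp _ x) (g x) ∂μ'
        = ∫ x, inner ℝ (((ρ x : ℝ) ^ (-(1 / p))) • G x) (g x) ∂μ' := by
      refine integral_congr_ae ?_
      filter_upwards [hS.coeFn_toLp] with x hx
      rw [hx]
    -- The weights match because `ρ · ρ ^ (-1/p) = ρ ^ (1/q)`.
    rw [h3, hμ', integral_withDensity_eq_integral_smul hρm]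
    congr 1; ext x
    rw [NNReal.smul_def, inner_smul_left, inner_smul_right, RCLike.conj_to_real, smul_eq_mul,
      ← mul_assoc]
    congr 1
    rw [mul_comm, ← Real.rpow_add_one (hpos x).ne']
    congr 1
    have := hpq.inv_add_inv_eq_one
    rw [one_div, one_div]
    linarith

end LpDuality

/-! ### Integration against signed measures -/

section SignedMeasure

variable {α E F : Type*} [MeasurableSpace α] [NormedAddCommGroup E] [NormedSpace ℝ E]
  [NormedAddCommGroup F] [NormedSpace ℝ F]

instance isFiniteMeasure_variation (ρ : SignedMeasure α) : IsFiniteMeasure ρ.variation := by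
  rw [← SignedMeasure.totalVariation_eq_variation, SignedMeasure.totalVariation]
  infer_instance

theorem signedIntegral_eq_sub (ρ : SignedMeasure α) {f : α → E}
    (hf : Integrable f ρ.variation) :
    ∫ᵛ y, f y ∂<•ρ = ∫ y, f y ∂ρ.toJordanDecomposition.posPart
      - ∫ y, f y ∂ρ.toJordanDecomposition.negPart := by
  set j := ρ.toJordanDecomposition
  have h := hf
  rw [← SignedMeasure.totalVariation_eq_variation, SignedMeasure.totalVariation,
    integrable_add_measure] at h
  conv_lhs => rw [← SignedMeasure.toSignedMeasure_toJordanDecomposition ρ]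
  rw [JordanDecomposition.toSignedMeasure, VectorMeasure.integral_sub_vectorMeasure,
    VectorMeasure.integral_toSignedMeasure, VectorMeasure.integral_toSignedMeasure]
  · simpa [VectorMeasure.Integrable] using h.1
  · simpa [VectorMeasure.Integrable] using h.2

theorem signedIntegral_clm_comp [CompleteSpace E] [CompleteSpace F] (ρ : SignedMeasure α)
    (T : E →L[ℝ] F) {f : α → E} (hf : Integrable f ρ.variation) :
    ∫ᵛ y, T (f y) ∂<•ρ = T (∫ᵛ y, f y ∂<•ρ) := by
  have h := hf
  rw [← SignedMeasure.totalVariation_eq_variation, SignedMeasure.totalVariation,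
    integrable_add_measure] at h
  rw [signedIntegral_eq_sub ρ hf, signedIntegral_eq_sub ρ (T.integrable_comp hf),
    T.integral_comp_comm h.1, T.integral_comp_comm h.2, map_sub]

end SignedMeasure

/-! ### Admissible measures and reduction to the identity similarity -/

variable {ρ : SignedMeasure (Space n)}

theorem Admissible.integrable_of_continuous (hρ : Admissible ρ) {E : Type*}
    [NormedAddCommGroup E] {f : Space n → E} (hf : Continuous f) :
    Integrable f ρ.variation := by
  obtain ⟨C, hC⟩ := hρ.isCompact_support.exists_bound_of_continuousOn hf.continuousOn
  refine Integrable.of_bound hf.aestronglyMeasurable C ?_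
  filter_upwards [Measure.support_mem_ae] with x hx using hC x hx

theorem Admissible.dim_ne_zero (hρ : Admissible ρ) : n ≠ 0 := by
  rintro rfl
  exact hρ.firstMoment_ne_zero (Subsingleton.elim _ _)

/-- Zero total mass allows subtracting the constant `m` of Morrey's inequality, and on the compact
support the linear growth is bounded. -/
theorem Admissible.exists_integral_bound (hρ : Admissible ρ) (hn : (n : ℝ) < p)
    (hpq : p.HolderConjugate q) :
    ∃ C : ℝ, ∀ u ∈ D1p n p, |∫ᵛ y, u y ∂•ρ| ≤ C * fieldNorm p (weakGradient u) := by
  obtain ⟨A, hA, h⟩ := exists_morrey_bound (n := n) hn hpq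
  obtain ⟨R, hR⟩ := hρ.isCompact_support.isBounded.exists_norm_le
  let B := ContinuousLinearMap.lsmul ℝ ℝ (E := ℝ)
  refine ⟨A * (R + 1) * ‖B‖ * ρ.variation.real Set.univ, fun u hu => ?_⟩
  obtain ⟨m, hm⟩ := h u hu
  have h1 : ∫ᵛ y, u y ∂•ρ = ∫ᵛ y, (u y - m) ∂•ρ := by
    rw [VectorMeasure.integral_fun_sub (hρ.integrable_of_continuous hu.1)
      (hρ.integrable_of_continuous continuous_const), VectorMeasure.integral_const,
      hρ.total_eq_zero, map_zero, sub_zero]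
  rw [h1]
  have h2 : ∀ᵐ y ∂ρ.variation, ‖u y - m‖ ≤ A * (R + 1) * fieldNorm p (weakGradient u) := by
    filter_upwards [Measure.support_mem_ae] with y hy
    refine (hm y).trans ?_
    have := hR y hy
    gcongr
    exact ENNReal.toReal_nonneg
  refine (VectorMeasure.norm_integral_le_of_norm_le_const (B := B) h2).trans_eq ?_
  ring

theorem Admissible.firstMoment_map (hρ : Admissible ρ) (c : ℝ)
    (O : Space n ≃ₗᵢ[ℝ] Space n) (z : Space n) :
    ∫ᵛ x, x ∂<•(ρ.map fun y => c • O y + z) = c • O (∫ᵛ y, y ∂<•ρ) := by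
  have hS : Continuous fun y : Space n => c • O y + z := by fun_prop
  rw [VectorMeasure.integral_map (f := fun x => x) hS.measurable
    continuous_id.aestronglyMeasurable
    (hρ.integrable_of_continuous hS), VectorMeasure.integral_fun_add
      (hρ.integrable_of_continuous (by fun_prop))
      (hρ.integrable_of_continuous continuous_const), VectorMeasure.integral_const,
    hρ.total_eq_zero, VectorMeasure.integral_fun_smul]
  have := signedIntegral_clm_comp ρ (O.toContinuousLinearEquiv : Space n →L[ℝ] Space n)
    (hρ.integrable_of_continuous continuous_id)
  simp only [id, ContinuousLinearEquiv.coe_coe] at this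
  simpa using congrArg (c • ·) this

theorem Admissible.integral_map (hρ : Admissible ρ) {u : Space n → ℝ} (hu : Continuous u)
    {S : Space n → Space n} (hS : Continuous S) :
    ∫ᵛ x, u x ∂•(ρ.map S) = ∫ᵛ y, u (S y) ∂•ρ :=
  VectorMeasure.integral_map hS.measurable hu.aestronglyMeasurable
    (hρ.integrable_of_continuous (hu.comp hS))

theorem Admissible.ratio_map (hρ : Admissible ρ) {u : Space n → ℝ} (hu : Continuous u)
    {c : ℝ} (hc : 0 < c) (O : Space n ≃ₗᵢ[ℝ] Space n) (z : Space n) :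
    ratio p (ρ.map fun y => c • O y + z) u = |∫ᵛ y, u (c • O y + z) ∂•ρ|
      / (c ^ (1 - (n : ℝ) / p) * ‖∫ᵛ y, y ∂<•ρ‖ ^ (1 - (n : ℝ) / p)) := by
  rw [ratio, hρ.firstMoment_map, hρ.integral_map hu (by fun_prop), norm_smul,
    Real.norm_of_nonneg hc.le, LinearIsometryEquiv.norm_map,
    Real.mul_rpow hc.le (norm_nonneg _)]

/-- The Morrey constants of `ρ` are the bounds of the functional `u ↦ ∫ u dρ`, up to a power of
the first moment. -/
theorem Admissible.mem_morreyConstants_iff (hρ : Admissible ρ) (hp : 0 < p) {C : ℝ} :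
    C ∈ morreyConstants p ρ ↔ ∀ u ∈ D1p n p, |∫ᵛ y, u y ∂•ρ|
      ≤ C * ‖∫ᵛ y, y ∂<•ρ‖ ^ (1 - (n : ℝ) / p) * fieldNorm p (weakGradient u) := by
  have hM : 0 < ‖∫ᵛ y, y ∂<•ρ‖ ^ (1 - (n : ℝ) / p) :=
    Real.rpow_pos_of_pos (norm_pos_iff.2 hρ.firstMoment_ne_zero) _
  simp only [morreyConstants, Set.mem_ofPred_eq, rhoSeminorm, iSup_le_iff, EReal.coe_le_coe_iff]
  constructor
  · intro h u hu
    have h1 := h u hu _ ⟨1, LinearIsometryEquiv.refl ℝ _, 0, one_pos, rfl⟩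
    rw [hρ.ratio_map hu.1 one_pos, Real.one_rpow, one_mul, div_le_iff₀ hM] at h1
    simp only [LinearIsometryEquiv.coe_refl, id, one_smul, add_zero] at h1
    linarith
  · rintro h u hu S ⟨c, O, z, hc, rfl⟩
    have hcp : 0 < c ^ (1 - (n : ℝ) / p) := Real.rpow_pos_of_pos hc _
    rw [hρ.ratio_map hu.1 hc, div_le_iff₀ (mul_pos hcp hM)]
    -- Applying the bound to `u ∘ S` yields the factor `c ^ (1 - n/p)` that also stands in the
    -- denominator.
    have h1 := h _ (D1p.comp_similarity hu hc O z)
    rw [fieldNorm_weakGradient_comp_similarity hu hp hc O z] at h1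
    linarith

/-! ### Duality between bounds and fields -/

theorem abs_integral_le_of_divEq (hpq : p.HolderConjugate q) {F : Space n → Space n}
    (hF : MemLp F (ENNReal.ofReal q) volume) (hd : DivEq p F ρ) {u : Space n → ℝ}
    (hu : u ∈ D1p n p) :
    |∫ᵛ y, u y ∂•ρ| ≤ fieldNorm q F * fieldNorm p (weakGradient u) := by
  rw [← hd u hu, abs_neg, mul_comm]
  exact abs_integral_inner_le hpq (D1p.memLp hu) hF

/-- A bound of `ℓ` by the norm of a linear map `D` lets `ℓ` factor through `D`, with a factor of
norm at most the bound. -/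
theorem exists_clm_comp_eq {V W : Type*} [AddCommGroup V] [Module ℝ V] [NormedAddCommGroup W]
    [NormedSpace ℝ W] (D : V →ₗ[ℝ] W) (l : V →ₗ[ℝ] ℝ) {C : ℝ} (hC : 0 ≤ C)
    (h : ∀ v, |l v| ≤ C * ‖D v‖) : ∃ Λ : W →L[ℝ] ℝ, ‖Λ‖ ≤ C ∧ ∀ v, Λ (D v) = l v := by
  obtain ⟨s, hs⟩ := D.rangeRestrict.exists_rightInverse_of_surjective D.range_rangeRestrict
  have hs' : ∀ w : LinearMap.range D, D (s w) = w := fun w =>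
    congrArg Subtype.val (LinearMap.congr_fun hs w)
  let f : LinearMap.range D →L[ℝ] ℝ := (l.comp s).mkContinuous C fun w => by
    have := h (s w)
    rwa [hs' w] at this
  obtain ⟨Λ, hΛ, hn⟩ := exists_extension_norm_eq _ f
  refine ⟨Λ, hn.trans_le (LinearMap.mkContinuous_norm_le _ hC _), fun v => ?_⟩
  have h1 := hΛ ⟨D v, LinearMap.mem_range_self D v⟩
  rw [h1]
  change l (s ⟨D v, _⟩) = l v
  -- The bound forces `l` to vanish on the kernel of `D`, so the arbitrary section `s` does not
  -- affect the value.
  have h2 := h (s ⟨D v, LinearMap.mem_range_self D v⟩ - v)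
  rw [map_sub, map_sub, hs', sub_self, norm_zero, mul_zero] at h2
  exact sub_eq_zero.1 (abs_eq_zero.1 (le_antisymm h2 (abs_nonneg _)))

/-- The functional `u ↦ ∫ u dρ` on `𝒟^{1,p}(ℝⁿ)`. -/
def Admissible.functional (hρ : Admissible ρ) (p : ℝ) : D1pSubmodule n p →ₗ[ℝ] ℝ where
  toFun u := ∫ᵛ y, (u : Space n → ℝ) y ∂•ρ
  map_add' u v := VectorMeasure.integral_add (hρ.integrable_of_continuous u.2.1)
    (hρ.integrable_of_continuous v.2.1)
  map_smul' c u := VectorMeasure.integral_smul (f := (u : Space n → ℝ)) (μ := ρ) _ c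

theorem Admissible.functional_apply (hρ : Admissible ρ) (u : D1pSubmodule n p) :
    hρ.functional p u = ∫ᵛ y, (u : Space n → ℝ) y ∂•ρ := rfl

theorem Admissible.exists_field (hρ : Admissible ρ) (hpq : p.HolderConjugate q) {C : ℝ}
    (hC : 0 ≤ C) (h : ∀ u ∈ D1p n p, |∫ᵛ y, u y ∂•ρ| ≤ C * fieldNorm p (weakGradient u)) :
    ∃ F : Space n → Space n, MemLp F (ENNReal.ofReal q) volume ∧ DivEq p F ρ ∧
      fieldNorm q F ≤ C := by
  have hfact : Fact (1 ≤ ENNReal.ofReal p) := ⟨by simpa using hpq.lt.le⟩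
  obtain ⟨Λ, hΛC, hΛ⟩ := exists_clm_comp_eq (gradientLp n p) (hρ.functional p) hC fun u => by
    rw [norm_gradientLp, hρ.functional_apply]
    exact h u u.2
  obtain ⟨F, hF, hFle, hΛF⟩ := exists_representation hpq Λ
  -- The sign compensates the minus in the definition of the divergence.
  refine ⟨-F, hF.neg, fun v hv => ?_, ?_⟩
  · have h1 := hΛ ⟨v, hv⟩
    rw [hΛF, pairing_apply, hρ.functional_apply] at h1
    rw [← h1, ← integral_neg]
    refine integral_congr_ae ?_
    filter_upwards [(D1p.memLp hv).coeFn_toLp] with x hx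
    change _ = inner ℝ ((D1p.memLp hv).toLp _ x) (F x)
    rw [hx, Pi.neg_apply, inner_neg_right, neg_neg]
  · rw [fieldNorm, eLpNorm_neg]
    refine (ENNReal.toReal_mono ENNReal.ofReal_ne_top hFle).trans ?_
    rwa [ENNReal.toReal_ofReal (norm_nonneg _)]

/-! ### Nonnegativity of the constants -/

theorem hasWeakGradient_gradient {φ : Space n → ℝ} (hφ : ContDiff ℝ ∞ φ)
    (hc : HasCompactSupport φ) : HasWeakGradient φ (gradient φ) := by
  refine ⟨hφ.continuous.locallyIntegrable, (continuous_gradient hφ).locallyIntegrable,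
    fun η hη hηc => ?_⟩
  have hI : ∀ {f g : Space n → ℝ}, ContDiff ℝ ∞ f → HasCompactSupport f → ContDiff ℝ ∞ g →
      Integrable fun x => f x • gradient g x := fun hf hfc hg =>
    (hf.continuous.smul (continuous_gradient hg)).integrable_of_hasCompactSupport
      hfc.smul_right
  have hL : ∀ (f : Space n → ℝ) (x w : Space n),
      InnerProductSpace.toDual ℝ (Space n) w (gradient f x) = fderiv ℝ f x w := fun f x w => by
    rw [InnerProductSpace.toDual_apply_apply, real_inner_comm, inner_gradient_left]
  refine ext_inner_left ℝ fun w => ?_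
  rw [← InnerProductSpace.toDual_apply_apply (𝕜 := ℝ),
    ← InnerProductSpace.toDual_apply_apply (𝕜 := ℝ), map_neg,
    ← ContinuousLinearMap.integral_comp_comm _ (hI hφ hc hη),
    ← ContinuousLinearMap.integral_comp_comm _ (hI hη hηc hφ)]
  simp only [map_smul, smul_eq_mul, hL]
  have hI' : ∀ {f g : Space n → ℝ}, ContDiff ℝ ∞ f → HasCompactSupport f → ContDiff ℝ ∞ g →
      Integrable fun x => f x * fderiv ℝ g x w := fun hf hfc hg => by
    simpa only [map_smul, smul_eq_mul, hL] using
      (InnerProductSpace.toDual ℝ (Space n) w).integrable_comp (hI hf hfc hg)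
  have h := integral_mul_fderiv_eq_neg_fderiv_mul_of_integrable (μ := (volume : Measure (Space n)))
    (f := φ) (g := η) (v := w) (by simpa only [mul_comm] using hI' hη hηc hφ) (hI' hφ hc hη)
    ((hφ.continuous.mul hη.continuous).integrable_of_hasCompactSupport hc.mul_right)
    (fun x _ => hφ.differentiable (by simp) x) (fun x _ => hη.differentiable (by simp) x)
  rw [h]
  simp only [mul_comm]

theorem testFunction_mem_D1p {φ : Space n → ℝ} (hφ : ContDiff ℝ ∞ φ)
    (hc : HasCompactSupport φ) : φ ∈ D1p n p :=
  ⟨hφ.continuous, hφ.continuous.locallyIntegrable, _, hasWeakGradient_gradient hφ hc,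
    (continuous_gradient hφ).memLp_of_hasCompactSupport (hasCompactSupport_gradient hc)⟩

/-- If a bump function had zero gradient norm, Morrey's inequality would make it constant, yet it
equals `1` at the origin and `0` far away. Far points exist because `n ≠ 0`. -/
theorem exists_fieldNorm_pos (hn0 : n ≠ 0) (hn : (n : ℝ) < p) (hpq : p.HolderConjugate q) :
    ∃ u ∈ D1p n p, 0 < fieldNorm p (weakGradient u) := by
  let φ : ContDiffBump (0 : Space n) := ⟨1, 2, by norm_num, by norm_num⟩
  have hφ : (φ : Space n → ℝ) ∈ D1p n p := testFunction_mem_D1p φ.contDiff φ.hasCompactSupport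
  refine ⟨φ, hφ, lt_of_le_of_ne ENNReal.toReal_nonneg fun h0 => ?_⟩
  obtain ⟨A, -, hA⟩ := exists_morrey_bound (n := n) hn hpq
  obtain ⟨m, hm⟩ := hA φ hφ
  rw [← h0] at hm
  have hc : ∀ x, φ x = m := fun x => by
    have := hm x
    rw [mul_zero] at this
    exact sub_eq_zero.1 (abs_eq_zero.1 (le_antisymm this (abs_nonneg _)))
  have : Nonempty (Fin n) := ⟨⟨0, Nat.pos_of_ne_zero hn0⟩⟩
  obtain ⟨v, hv⟩ := NormedSpace.exists_lt_norm ℝ (Space n) 2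
  have h1 : φ 0 = 1 := φ.one_of_mem_closedBall (Metric.mem_closedBall_self φ.rIn_pos.le)
  have h2 : φ v = 0 := φ.zero_of_le_dist (by simpa using hv.le)
  rw [hc] at h1 h2
  exact one_ne_zero (h1.symm.trans h2)

/-- Morrey constants range over all reals, whereas the Hahn–Banach step needs a nonnegative bound.
-/
theorem Admissible.bound_nonneg (hρ : Admissible ρ) (hn : (n : ℝ) < p)
    (hpq : p.HolderConjugate q) {C : ℝ}
    (h : ∀ u ∈ D1p n p, |∫ᵛ y, u y ∂•ρ| ≤ C * fieldNorm p (weakGradient u)) : 0 ≤ C := by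
  obtain ⟨u, hu, hpos⟩ := exists_fieldNorm_pos hρ.dim_ne_zero hn hpq
  exact nonneg_of_mul_nonneg_left ((abs_nonneg _).trans (h u hu)) hpos

end GenMorrey

end

/-! ### The sharp constant -/

theorem mainTheorem12 (n : ℕ) (p q : ℝ) (hn : (n : ℝ) < p) (hpq : p.HolderConjugate q)
    (ρ : SignedMeasure (GenMorrey.Space n)) (hρ : GenMorrey.Admissible ρ) :
    (GenMorrey.divFieldNorms p q ρ).Nonempty ∧
      IsLeast (GenMorrey.morreyConstants p ρ)
        (sInf (GenMorrey.divFieldNorms p q ρ) /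
          ‖∫ᵛ y, y ∂<•ρ‖ ^ (1 - (n : ℝ) / p)) := by
  have hM : 0 < ‖∫ᵛ y, y ∂<•ρ‖ ^ (1 - (n : ℝ) / p) :=
    Real.rpow_pos_of_pos (norm_pos_iff.2 hρ.firstMoment_ne_zero) _
  have hne : (GenMorrey.divFieldNorms p q ρ).Nonempty := by
    obtain ⟨C, hC⟩ := hρ.exists_integral_bound hn hpq
    obtain ⟨F, hF, hd, -⟩ := hρ.exists_field hpq (hρ.bound_nonneg hn hpq hC) hC
    exact ⟨_, F, hF, hd, rfl⟩
  have hbdd : BddBelow (GenMorrey.divFieldNorms p q ρ) := by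
    refine ⟨0, ?_⟩
    rintro _ ⟨F, -, -, rfl⟩
    exact ENNReal.toReal_nonneg
  refine ⟨hne, ?_, fun C hC => ?_⟩
  · rw [hρ.mem_morreyConstants_iff hpq.pos]
    intro u hu
    rw [div_mul_cancel₀ _ hM.ne']
    have hnn : 0 ≤ GenMorrey.fieldNorm p (GenMorrey.weakGradient u) := ENNReal.toReal_nonneg
    -- Passing to the infimum over `F` divides by `‖Du‖_p`; when this is zero, a single field
    -- already gives `∫ u dρ = 0`.
    rcases hnn.eq_or_lt' with h0 | h0
    · obtain ⟨_, F, hF, hd, rfl⟩ := hne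
      have := GenMorrey.abs_integral_le_of_divEq hpq hF hd hu
      rwa [h0, mul_zero] at this ⊢
    · rw [← div_le_iff₀ h0]
      refine le_csInf hne ?_
      rintro _ ⟨F, hF, hd, rfl⟩
      rw [div_le_iff₀ h0]
      exact GenMorrey.abs_integral_le_of_divEq hpq hF hd hu
  · rw [hρ.mem_morreyConstants_iff hpq.pos] at hC
    obtain ⟨F, hF, hd, hle⟩ := hρ.exists_field hpq (hρ.bound_nonneg hn hpq hC) hC
    rw [div_le_iff₀ hM]
    exact (csInf_le hbdd ⟨F, hF, hd, rfl⟩).trans hle
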